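/- Setting. Let $(S,P,R,\gamma)$ be a finite Markov reward process ($P$ a stochastic matrix, $R$ the expected reward, $0\le\gamma<1$), $\xi$ a strictly positive probability distribution on $S$, $\Xi=\mathrm{diag}(\xi)$, and $\Phi\in\mathbb R^{S\times d}$ a feature matrix with rows $\phi(s)^\top$ such that $G=\Phi^\top\Xi\Phi$ is invertible. Put $TV=R+\gamma PV$, $V_\theta=\Phi\theta$, $A=\Phi^\top\Xi(\Phi-\gamma P\Phi)$, $K(\theta)=\Phi^\top\Xi(TV_\theta-V_\theta)$, $F^*(w)=\tfrac12 w^\top Gw$, and $\mathrm{MSPBE}(\theta)=\|V_\theta-\Pi TV_\theta\|_\Xi^2$ with $\Pi=\Phi G^{-1}\Phi^\top\Xi$. Let $X,Y\subset\mathbb R^d$ be nonempty, compact and convex, let $h$ be convex and continuous on $X$, and let $$L(\theta,w)=\langle K(\theta),w\rangle-F^*(w)+h(\theta),\qquad \mathrm{Gap}(\theta,w)=\max_{w'\in Y}L(\theta,w')-\min_{\theta'\in X}L(\theta',w).$$ Let $(s_t,r_t,s'_t)_{t\ge0}$ be i.i.d. with $s_t\sim\xi$, $s'_t\sim P(s_t,\cdot)$,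 $\mathbb E[r_t\mid s_t]=R(s_t)$, $\mathbb E[r_t^2]<\infty$; write $\phi_t=\phi(s_t)$, $\phi'_t=\phi(s'_t)$, $\delta_t(\theta)=r_t+\gamma\phi_t'^\top\theta-\phi_t^\top\theta$. Let $\sigma_{F^*},\sigma_{K,\theta},\sigma_{K,y}\ge0$ be such that for all $\theta\in X$, $w\in Y$ $$\mathbb E\|\phi_t\phi_t^\top w-Gw\|^2\le\sigma_{F^*}^2,\quad \mathbb E\|\delta_t(\theta)\phi_t-K(\theta)\|^2\le\sigma_{K,\theta}^2,\quad \mathbb E\|(\phi_t-\gamma\phi_t')\phi_t^\top w-A^\top w\|^2\le\sigma_{K,y}^2,$$ and put $\sigma=\sqrt{\sigma_{F^*}^2+\sigma_{K,\theta}^2}+\sigma_{K,y}$, $L_{F^*}=\|G\|_2$, $L_K=\|A\|_2$ (spectral norms). Algorithm (GTD2-MP). Write $\mathrm{prox}_{f}(v)=\arg\min_{u\in X}\big(f(u)+\tfrac12\|u-v\|^2\big)$ and let $\Pi_Y$ be the Euclidean projection onto $Y$. From $\theta_0\in X$, $w_0\in Y$ compute $$w_{t+\frac12}=\Pi_Y\big(w_t+\beta_t(\delta_t(\theta_t)-\phi_t^\top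 w_t)\phi_t\big),\quad \theta_{t+\frac12}=\mathrm{prox}_{\alpha_t h}\big(\theta_t+\alpha_t(\phi_t-\gamma\phi'_t)(\phi_t^\top w_t)\big),$$ $$w_{t+1}=\Pi_Y\big(w_t+\beta_t(\delta_t(\theta_{t+\frac12})-\phi_t^\top w_{t+\frac12})\phi_t\big),\quad \theta_{t+1}=\mathrm{prox}_{\alpha_t h}\big(\theta_t+\alpha_t(\phi_t-\gamma\phi'_t)(\phi_t^\top w_{t+\frac12})\big),$$ and after $N$ steps output the averages $\bar\theta_N=\frac1N\sum_{t<N}\theta_{t+\frac12}$, $\bar w_N=\frac1N\sum_{t<N}w_{t+\frac12}$. Proposition 2. For every $c\in(0,\tfrac12]$ and all $X,Y$ as above there is a constant $C>0$, depending only on $c$, $X$ and $Y$, such that for every Markov reward process, $\xi$, $\Phi$, $h$, sample law, variance bounds, starting point and $N\ge1$ as above, GTD2-MP with the constant stepsizes $\alpha_t=\beta_t=c/(L_{F^*}+L_K+\sigma\sqrt N)$ satisfies $$\mathbb E\big[\mathrm{Gap}(\bar\theta_N,\bar w_N)\big]\le C\Big(\frac{L_{F^*}+L_K}{N}+\frac{\sigma}{\sqrt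 N}\Big).$$ If moreover $Y$ contains the unconstrained dual maximizers $G^{-1}K(\theta)$, $\theta\in X$ (so that $\min_X\max_Y L$ is the saddle-point form of $\min_{\theta\in X}\frac12\mathrm{MSPBE}(\theta)+h(\theta)$), then with the same $C$ $$\mathbb E\big[\tfrac12\mathrm{MSPBE}(\bar\theta_N)+h(\bar\theta_N)\big]-\min_{\theta\in X}\big(\tfrac12\mathrm{MSPBE}(\theta)+h(\theta)\big)\le C\Big(\frac{L_{F^*}+L_K}{N}+\frac{\sigma}{\sqrt N}\Big).$$ The random quantities under both expectations are integrable. -/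

import Mathlib

open MeasureTheory ProbabilityTheory
open scoped Matrix

universe u v

noncomputable section

namespace GTD2

/-- The parameter space `ℝ^d` with its Euclidean norm. -/
abbrev Vec (d : ℕ) : Type := EuclideanSpace ℝ (Fin d)

/-- A finite Markov reward process: transition matrix `P`, expected one-step reward `R`
and discount factor `γ`. -/
structure MRP (S : Type*) [Fintype S] where
  P : Matrix S S ℝ
  R : S → ℝ
  γ : ℝ
  P_nonneg : ∀ s s', 0 ≤ P s s'
  P_sum : ∀ s, ∑ s', P s s' = 1
  γ_nonneg : 0 ≤ γ
  γ_lt_one : γ < 1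

/-- `ξ` is a positive probability distribution on the states. -/
structure IsPosDistribution {S : Type*} [Fintype S] (ξ : S → ℝ) : Prop where
  pos : ∀ s, 0 < ξ s
  sum_eq_one : ∑ s, ξ s = 1

section Objective

variable {S : Type*} [Fintype S] [DecidableEq S] {d : ℕ}

/-- The Bellman operator `T V = R + γ P V`. -/
def bellman (M : MRP S) (V : S → ℝ) : S → ℝ := M.R + M.γ • (M.P *ᵥ V)

/-- The linear value function `V_θ = Φ θ`. -/
def value (Φ : Matrix S (Fin d) ℝ) (θ : Vec d) : S → ℝ := Φ *ᵥ θ.ofLp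

/-- The feature covariance `Φᵀ Ξ Φ = E[φ φᵀ]`. -/
def gram (Φ : Matrix S (Fin d) ℝ) (ξ : S → ℝ) : Matrix (Fin d) (Fin d) ℝ :=
  Φᵀ * Matrix.diagonal ξ * Φ

/-- The matrix `Φᵀ Ξ (Φ - γ Φ') = E[φ (φ - γ φ')ᵀ]`, where `Φ' = P Φ` holds the expected
next features. -/
def coupling (M : MRP S) (Φ : Matrix S (Fin d) ℝ) (ξ : S → ℝ) : Matrix (Fin d) (Fin d) ℝ :=
  Φᵀ * Matrix.diagonal ξ * (Φ - M.γ • (M.P * Φ))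

/-- `K(θ) = Φᵀ Ξ (T V_θ - V_θ) = Φᵀ Ξ (R + γ Φ' θ - Φ θ)`. -/
def K (M : MRP S) (Φ : Matrix S (Fin d) ℝ) (ξ : S → ℝ) (θ : Vec d) : Vec d :=
  WithLp.toLp 2 (Φᵀ *ᵥ (Matrix.diagonal ξ *ᵥ (bellman M (value Φ θ) - value Φ θ)))

/-- The matrix of the `Ξ`-orthogonal projection onto the column space of `Φ`. -/
def projMatrix (Φ : Matrix S (Fin d) ℝ) (ξ : S → ℝ) : Matrix S S ℝ :=
  Φ * (gram Φ ξ)⁻¹ * Φᵀ * Matrix.diagonal ξ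

/-- The mean-square projected Bellman error `‖V_θ - Π T V_θ‖²_Ξ`. -/
def mspbe (M : MRP S) (Φ : Matrix S (Fin d) ℝ) (ξ : S → ℝ) (θ : Vec d) : ℝ :=
  ∑ s, ξ s * (value Φ θ s - (projMatrix Φ ξ *ᵥ bellman M (value Φ θ)) s) ^ 2

/-- `F*(w) = ½ ‖w‖²_{ΦᵀΞΦ}`. -/
def Fstar (Φ : Matrix S (Fin d) ℝ) (ξ : S → ℝ) (w : Vec d) : ℝ :=
  1 / 2 * inner ℝ w (Matrix.toEuclideanCLM (𝕜 := ℝ) (gram Φ ξ) w)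

/-- The primal-dual loss `L(θ, w) = ⟨K(θ), w⟩ - F*(w) + h(θ)`. -/
def saddle (M : MRP S) (Φ : Matrix S (Fin d) ℝ) (ξ : S → ℝ) (h : Vec d → ℝ)
    (θ w : Vec d) : ℝ :=
  inner ℝ (K M Φ ξ θ) w - Fstar Φ ξ w + h θ

/-- The duality gap `max_{w ∈ Y} L(θ̄, w) - min_{θ ∈ X} L(θ, w̄)` of `z = (θ̄, w̄)`. -/
def dualityGap (M : MRP S) (Φ : Matrix S (Fin d) ℝ) (ξ : S → ℝ) (h : Vec d → ℝ)
    (X Y : Set (Vec d)) (z : Vec d × Vec d) : ℝ :=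
  sSup ((fun w => saddle M Φ ξ h z.1 w) '' Y) - sInf ((fun θ => saddle M Φ ξ h θ z.2) '' X)

/-- The Lipschitz constant `‖Φᵀ Ξ Φ‖₂` (spectral norm) of `∇F*`. -/
def lipF (Φ : Matrix S (Fin d) ℝ) (ξ : S → ℝ) : ℝ :=
  ‖Matrix.toEuclideanCLM (𝕜 := ℝ) (gram Φ ξ)‖

/-- The Lipschitz constant `‖Φᵀ Ξ (Φ - γ Φ')‖₂` (spectral norm) of `K`. -/
def lipK (M : MRP S) (Φ : Matrix S (Fin d) ℝ) (ξ : S → ℝ) : ℝ :=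
  ‖Matrix.toEuclideanCLM (𝕜 := ℝ) (coupling M Φ ξ)‖

end Objective

section Sampling

variable {S : Type*} {d : ℕ}

/-- The feature vector `φ(s)`, i.e. row `s` of `Φ`. -/
def feat (Φ : Matrix S (Fin d) ℝ) (s : S) : Vec d := WithLp.toLp 2 (Φ s)

/-- `ν` is a law of transition samples `(s, r, s')`: `s` has distribution `ξ`, the next state
is drawn from `P(s, ·)`, and `r` is square integrable with conditional mean `R(s)`. -/
structure IsSampleLaw [Fintype S] [MeasurableSpace S] (M : MRP S) (ξ : S → ℝ)
    (ν : Measure (S × ℝ × S)) : Prop where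
  transition : ∀ s s', ν {x | x.1 = s ∧ x.2.2 = s'} = ENNReal.ofReal (ξ s * M.P s s')
  reward_memLp : MemLp (fun x => x.2.1) 2 ν
  reward_mean : ∀ s, ∫ x in {x | x.1 = s}, x.2.1 ∂ν = ξ s * M.R s

/-- The temporal difference error `δ(θ) = r + γ φ'ᵀ θ - φᵀ θ` on the sample `x = (s, r, s')`. -/
def tdError (γ : ℝ) (Φ : Matrix S (Fin d) ℝ) (x : S × ℝ × S) (θ : Vec d) : ℝ :=
  x.2.1 + γ * inner ℝ (feat Φ x.2.2) θ - inner ℝ (feat Φ x.1) θ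

/-- The stochastic oracle `φ φᵀ w` for `∇F*(w)`. -/
def oracleF (Φ : Matrix S (Fin d) ℝ) (x : S × ℝ × S) (w : Vec d) : Vec d :=
  (inner ℝ (feat Φ x.1) w : ℝ) • feat Φ x.1

/-- The stochastic oracle `δ(θ) φ` for `K(θ)`. -/
def oracleK (γ : ℝ) (Φ : Matrix S (Fin d) ℝ) (x : S × ℝ × S) (θ : Vec d) : Vec d :=
  tdError γ Φ x θ • feat Φ x.1

/-- The stochastic oracle `-(φ - γ φ') φᵀ w` for `∇K(θ)ᵀ w`. -/
def oracleKT (γ : ℝ) (Φ : Matrix S (Fin d) ℝ) (x : S × ℝ × S) (w : Vec d) : Vec d :=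
  -((inner ℝ (feat Φ x.1) w : ℝ) • (feat Φ x.1 - γ • feat Φ x.2.2))

/-- The three oracles have variances at most `σF²`, `σKθ²`, `σKy²` on the feasible sets. -/
structure OracleVarianceBound [Fintype S] [DecidableEq S] [MeasurableSpace S] (M : MRP S)
    (Φ : Matrix S (Fin d) ℝ) (ξ : S → ℝ) (ν : Measure (S × ℝ × S)) (X Y : Set (Vec d))
    (σF σKθ σKy : ℝ) : Prop where
  varF : ∀ w ∈ Y,
    ∫ x, ‖oracleF Φ x w - Matrix.toEuclideanCLM (𝕜 := ℝ) (gram Φ ξ) w‖ ^ 2 ∂ν ≤ σF ^ 2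
  varK : ∀ θ ∈ X, ∫ x, ‖oracleK M.γ Φ x θ - K M Φ ξ θ‖ ^ 2 ∂ν ≤ σKθ ^ 2
  varKT : ∀ w ∈ Y,
    ∫ x, ‖oracleKT M.γ Φ x w
      - (-(Matrix.toEuclideanCLM (𝕜 := ℝ) (coupling M Φ ξ)ᵀ w))‖ ^ 2 ∂ν ≤ σKy ^ 2

end Sampling

section Algorithm

variable {S : Type*} {d : ℕ}

/-- The proximal mapping `argmin_{u ∈ C} (f(u) + ½ ‖u - x‖²)`. For compact convex nonempty `C`
and continuous convex `f` the minimizer exists and is unique. -/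
def prox (C : Set (Vec d)) (f : Vec d → ℝ) (x : Vec d) : Vec d :=
  Classical.epsilon fun u => u ∈ C ∧ IsMinOn (fun v => f v + 1 / 2 * ‖v - x‖ ^ 2) C u

/-- One proximal step from `z = (θ, w)`, using the sample `x` and the oracles at `g`. The prox
of the zero function over `Y` is the Euclidean projection onto `Y`. -/
def proxStep (X Y : Set (Vec d)) (h : Vec d → ℝ) (γ : ℝ) (Φ : Matrix S (Fin d) ℝ) (α β : ℝ)
    (x : S × ℝ × S) (z g : Vec d × Vec d) : Vec d × Vec d :=
  (prox X (fun u => α * h u)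
      (z.1 + (α * inner ℝ (feat Φ x.1) g.2) • (feat Φ x.1 - γ • feat Φ x.2.2)),
   prox Y (fun _ => 0)
      (z.2 + (β * (tdError γ Φ x g.1 - inner ℝ (feat Φ x.1) g.2)) • feat Φ x.1))

/-- The iterates `z_t = (θ_t, w_t)` of GTD2-MP along the sample path `x`; the extrapolation step
and the update step at time `t` use the same sample `x t`. -/
def iter (X Y : Set (Vec d)) (h : Vec d → ℝ) (γ : ℝ) (Φ : Matrix S (Fin d) ℝ) (α β : ℕ → ℝ)
    (x : ℕ → S × ℝ × S) (z₀ : Vec d × Vec d) : ℕ → Vec d × Vec d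
  | 0 => z₀
  | t + 1 =>
    let z := iter X Y h γ Φ α β x z₀ t
    proxStep X Y h γ Φ (α t) (β t) (x t) z (proxStep X Y h γ Φ (α t) (β t) (x t) z z)

/-- The extragradient points `z_{t+1/2} = (θ_{t+1/2}, w_{t+1/2})` of GTD2-MP. -/
def halfIter (X Y : Set (Vec d)) (h : Vec d → ℝ) (γ : ℝ) (Φ : Matrix S (Fin d) ℝ)
    (α β : ℕ → ℝ) (x : ℕ → S × ℝ × S) (z₀ : Vec d × Vec d) (t : ℕ) : Vec d × Vec d :=
  proxStep X Y h γ Φ (α t) (β t) (x t) (iter X Y h γ Φ α β x z₀ t) (iter X Y h γ Φ α β x z₀ t)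

/-- The mirror-prox output after `N` steps: the average of the `N` extragradient points. -/
def average (X Y : Set (Vec d)) (h : Vec d → ℝ) (γ : ℝ) (Φ : Matrix S (Fin d) ℝ)
    (α β : ℕ → ℝ) (x : ℕ → S × ℝ × S) (z₀ : Vec d × Vec d) (N : ℕ) : Vec d × Vec d :=
  (N : ℝ)⁻¹ • ∑ t ∈ Finset.range N, halfIter X Y h γ Φ α β x z₀ t

end Algorithm

end GTD2

end

/-! The gap is the regret of a mirror-prox scheme for the monotone operator `field`, with block rows
(0, -Aᵀ) and (A, G) up to a constant. Its Lipschitz constant is at most ‖G‖ + ‖A‖, so without noise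
the extragradient inequality telescopes and gives the rate 1/N.

The difficulty is the noise. Both half steps use the same sample, so the noise Δ at z_{t+1/2} is not
centred given the past. But Δ is an affine function of the query point, and with zh the
extragradient point ⟨Δ(zh), u - zh⟩ = ⟨Δ(zh) - Δ(z), u - zh⟩ + ⟨Δ(z), z - zh⟩ + ⟨Δ(z), u - z⟩. The
first two terms carry a factor ‖zh - z‖. By Young's inequality they cost O(α²) times the squared
size and Lipschitz constant of Δ, plus a multiple of ‖zh - z‖², which the extragradient inequality
absorbs (`noisy_extragradient_step`). In the third term Δ is evaluated at z_t, which depends only on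
earlier samples. The comparison point u is a maximizer and depends on the whole path, so u - z_t is
split at z₀: the part z₀ - z_t has mean zero, and the part u - z₀ costs the diameter times ‖Σ
Δ(z_t)‖, of expected order √N because the increments are orthogonal
(`integral_norm_sum_noise_sq_le`).

It remains to bound the Lipschitz constant of Δ by the variances alone, since C may depend on the
problem only through X and Y. An affine map on the affine hull of X × Y is determined by its values
at finitely many points of X × Y, with constants depending on that set only (`exists_test_points`).
Summing the squared noise over these points gives a function Q of the sample that controls size and
Lipschitz constant together, with mean O(σ²) (`exists_noise_bound`).

If the dual maximizers lie in Y, the gap dominates the primal suboptimality pointwise. -/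

namespace GTD2

/-! ### Proximal maps on compact convex sets -/

section Prox

variable {d : ℕ} {C : Set (Vec d)} {f : Vec d → ℝ}

theorem prox_spec (hC : IsCompact C) (hne : C.Nonempty) (hf : ContinuousOn f C) (x : Vec d) :
    prox C f x ∈ C ∧ IsMinOn (fun v => f v + 1 / 2 * ‖v - x‖ ^ 2) C (prox C f x) := by
  have hcont : ContinuousOn (fun v => f v + 1 / 2 * ‖v - x‖ ^ 2) C :=
    hf.add (Continuous.continuousOn (by fun_prop))
  obtain ⟨u, hu, hmin⟩ := hC.exists_isMinOn hne hcont
  exact Classical.epsilon_spec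
    (p := fun u => u ∈ C ∧ IsMinOn (fun v => f v + 1 / 2 * ‖v - x‖ ^ 2) C u) ⟨u, hu, hmin⟩

/-- The variational inequality that characterizes the proximal point. -/
theorem prox_variational (hC : IsCompact C) (hne : C.Nonempty) (hf : ContinuousOn f C)
    (hconv : ConvexOn ℝ C f) (x : Vec d) {v : Vec d} (hv : v ∈ C) :
    f (prox C f x) - f v ≤ inner ℝ (prox C f x - x) (v - prox C f x) := by
  obtain ⟨hu, hmin⟩ := prox_spec hC hne hf x
  set u := prox C f x with hu_def
  -- Minimality is tested against a point of the segment from `u` to `v`. The quadratic term leaves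
  -- an error of order t after division by t, which vanishes as t → 0.
  have key : ∀ t : ℝ, 0 < t → t ≤ 1 →
      f u - f v ≤ inner ℝ (u - x) (v - u) + t * (1 / 2 * ‖v - u‖ ^ 2) := by
    intro t ht ht1
    have hmem : (1 - t) • u + t • v ∈ C := hconv.1 hu hv (by linarith) ht.le (by ring)
    have h1 := hmin hmem
    have h2 := hconv.2 hu hv (by linarith : (0 : ℝ) ≤ 1 - t) ht.le (by ring)
    have h3 : (1 - t) • u + t • v - x = (u - x) + t • (v - u) := by module
    have h4 : ‖(1 - t) • u + t • v - x‖ ^ 2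
        = ‖u - x‖ ^ 2 + 2 * (t * inner ℝ (u - x) (v - u)) + t ^ 2 * ‖v - u‖ ^ 2 := by
      rw [h3, norm_add_sq_real, inner_smul_right, norm_smul, mul_pow, Real.norm_eq_abs, sq_abs]
    simp only [Set.mem_ofPred_eq, smul_eq_mul] at h1 h2
    rw [h4] at h1
    refine le_of_mul_le_mul_left ?_ ht
    nlinarith
  have hlim : Filter.Tendsto
      (fun t : ℝ => inner ℝ (u - x) (v - u) + t * (1 / 2 * ‖v - u‖ ^ 2))
      (nhdsWithin 0 (Set.Ioi 0)) (nhds (inner ℝ (u - x) (v - u) + 0 * (1 / 2 * ‖v - u‖ ^ 2))) :=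
    (Continuous.tendsto (by fun_prop) 0).mono_left nhdsWithin_le_nhds
  rw [zero_mul, add_zero] at hlim
  refine ge_of_tendsto hlim ?_
  filter_upwards [Ioc_mem_nhdsGT (zero_lt_one' ℝ)] with t ht using key t ht.1 ht.2

/-- The map is nonexpansive: the variational inequalities at the two proximal points, each tested at
the other point, are added. Continuity serves the measurability of the iterates. -/
theorem continuous_prox (hC : IsCompact C) (hne : C.Nonempty) (hf : ContinuousOn f C)
    (hconv : ConvexOn ℝ C f) : Continuous (prox C f) := by
  refine LipschitzWith.continuous (K := 1) (LipschitzWith.of_dist_le_mul fun x y => ?_)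
  have hx := prox_variational hC hne hf hconv x (prox_spec hC hne hf y).1
  have hy := prox_variational hC hne hf hconv y (prox_spec hC hne hf x).1
  set p := prox C f x
  set q := prox C f y
  have h1 : inner ℝ (p - x) (q - p) + inner ℝ (q - y) (p - q)
      = inner ℝ (x - y) (p - q) - ‖p - q‖ ^ 2 := by
    rw [← real_inner_self_eq_norm_sq, ← inner_sub_left, ← neg_sub p q, inner_neg_right,
      ← inner_neg_left, ← inner_add_left]
    congr 1
    abel
  have h2 := real_inner_le_norm (x - y) (p - q)
  rw [dist_eq_norm, dist_eq_norm, NNReal.coe_one, one_mul]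
  by_contra hlt
  push Not at hlt
  nlinarith [norm_nonneg (x - y), norm_nonneg (p - q)]

end Prox

/-! ### The extragradient inequality, without and with noise -/

section MirrorProx

variable {V : Type*} [NormedAddCommGroup V] [InnerProductSpace ℝ V]

/-- The basic inequality of an extragradient step from `z` with extrapolation point `zh` and new
iterate `zp`, derived from the two variational inequalities of the proximal steps. -/
theorem extragradient_step {z zh zp u g gh : V} {α fh fp fu : ℝ}
    (h1 : fh - fp ≤ inner ℝ (zh - z + α • g) (zp - zh))
    (h2 : fp - fu ≤ inner ℝ (zp - z + α • gh) (u - zp)) :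
    fh - fu + α * inner ℝ gh (zh - u) ≤ 1 / 2 * ‖z - u‖ ^ 2 - 1 / 2 * ‖zp - u‖ ^ 2
      - 1 / 2 * ‖zh - z‖ ^ 2 - 1 / 2 * ‖zp - zh‖ ^ 2 + α * inner ℝ (gh - g) (zh - zp) := by
  -- The claim is the sum of `h1` and `h2`: polarization turns both inner products of differences
  -- into squares, and ‖zp - z‖² cancels.
  simp only [← real_inner_self_eq_norm_sq, inner_sub_left, inner_sub_right, inner_add_left,
    real_inner_smul_left] at *
  have e1 := real_inner_comm z zh
  have e2 := real_inner_comm z zp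
  have e3 := real_inner_comm z u
  have e4 := real_inner_comm zh zp
  have e5 := real_inner_comm zh u
  have e6 := real_inner_comm zp u
  linarith

/-- Young's inequality for inner products. -/
theorem mul_inner_le (a b : V) (α : ℝ) {κ : ℝ} (hκ : κ ≠ 0) :
    α * inner ℝ a b ≤ κ ^ 2 / 2 * α ^ 2 * ‖a‖ ^ 2 + 1 / (2 * κ ^ 2) * ‖b‖ ^ 2 := by
  have h0 := sq_nonneg ‖(κ * α) • a - κ⁻¹ • b‖
  rw [norm_sub_sq_real, norm_smul, norm_smul, inner_smul_left, inner_smul_right, mul_pow,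
    mul_pow, Real.norm_eq_abs, Real.norm_eq_abs, sq_abs, sq_abs] at h0
  simp only [conj_trivial] at h0
  have e : κ * α * (κ⁻¹ * inner ℝ a b) = α * inner ℝ a b := by field_simp
  rw [e] at h0
  have e2 : 1 / (2 * κ ^ 2) * ‖b‖ ^ 2 = 1 / 2 * (κ⁻¹ ^ 2 * ‖b‖ ^ 2) := by field_simp
  rw [e2]
  nlinarith

/-- An extragradient step with the noisy oracle `F + Δ`, both half steps using the same noise:
if `Δ` is of size `√Q` and Lipschitz with constant `√Q`, then the step errs by `O(α² Q)` only. -/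
theorem noisy_extragradient_step {z zh zp u : V} {F Δ : V → V} {α fh fp fu Lc D Q : ℝ}
    (hα : 0 ≤ α) (hL : 0 ≤ Lc) (hαL : α * Lc ≤ 1 / 2)
    (h1 : fh - fp ≤ inner ℝ (zh - z + α • (F z + Δ z)) (zp - zh))
    (h2 : fp - fu ≤ inner ℝ (zp - z + α • (F zh + Δ zh)) (u - zp))
    (hF : ‖F zh - F z‖ ≤ Lc * ‖zh - z‖) (hΔz : ‖Δ z‖ ^ 2 ≤ Q) (hΔh : ‖Δ zh‖ ^ 2 ≤ Q)
    (hΔ : ‖Δ zh - Δ z‖ ^ 2 ≤ Q * ‖zh - z‖ ^ 2) (hD : ‖u - zh‖ ≤ D) :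
    fh - fu + α * inner ℝ (F zh) (zh - u) ≤ 1 / 2 * ‖z - u‖ ^ 2 - 1 / 2 * ‖zp - u‖ ^ 2
      + α ^ 2 * ((6 + 2 * D ^ 2) * Q) + α * inner ℝ (Δ z) (u - z) := by
  have hstep := extragradient_step h1 h2
  have hα2 : 0 ≤ α ^ 2 := sq_nonneg α
  -- the Young inequalities
  have y1 : α * inner ℝ (F zh + Δ zh - (F z + Δ z)) (zh - zp)
      ≤ 1 / 2 * α ^ 2 * ‖F zh + Δ zh - (F z + Δ z)‖ ^ 2 + 1 / 2 * ‖zp - zh‖ ^ 2 := by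
    have := mul_inner_le (F zh + Δ zh - (F z + Δ z)) (zh - zp) α one_ne_zero
    rw [norm_sub_rev zp zh]
    norm_num at this ⊢
    exact this
  have y2 : ‖F zh + Δ zh - (F z + Δ z)‖ ^ 2 ≤ 2 * (Lc * ‖zh - z‖) ^ 2 + 8 * Q := by
    have e : F zh + Δ zh - (F z + Δ z) = (F zh - F z) + (Δ zh - Δ z) := by abel
    have n1 := norm_add_le (F zh - F z) (Δ zh - Δ z)
    have n2 := norm_sub_le (Δ zh) (Δ z)
    have n3 : ‖F zh - F z‖ ^ 2 ≤ (Lc * ‖zh - z‖) ^ 2 :=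
      pow_le_pow_left₀ (norm_nonneg _) hF 2
    have n4 : ‖Δ zh - Δ z‖ ^ 2 ≤ 4 * Q := by
      have := pow_le_pow_left₀ (norm_nonneg _) n2 2
      nlinarith [sq_nonneg (‖Δ zh‖ - ‖Δ z‖)]
    rw [e]
    have := pow_le_pow_left₀ (norm_nonneg _) n1 2
    nlinarith [sq_nonneg (‖F zh - F z‖ - ‖Δ zh - Δ z‖)]
  -- The only place where the smallness of the stepsize enters.
  have y3 : α ^ 2 * (Lc * ‖zh - z‖) ^ 2 ≤ 1 / 4 * ‖zh - z‖ ^ 2 := by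
    have : (α * Lc) ^ 2 ≤ (1 / 2) ^ 2 := pow_le_pow_left₀ (by positivity) hαL 2
    calc α ^ 2 * (Lc * ‖zh - z‖) ^ 2 = (α * Lc) ^ 2 * ‖zh - z‖ ^ 2 := by ring
      _ ≤ (1 / 2) ^ 2 * ‖zh - z‖ ^ 2 := by gcongr
      _ = _ := by ring
  have y4 : α * inner ℝ (Δ z) (z - zh) ≤ 2 * α ^ 2 * ‖Δ z‖ ^ 2 + 1 / 8 * ‖zh - z‖ ^ 2 := by
    have := mul_inner_le (Δ z) (z - zh) α two_ne_zero
    rw [norm_sub_rev zh z]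
    norm_num at this ⊢
    exact this
  have y5 : α * inner ℝ (Δ zh - Δ z) (u - zh) ≤ 2 * α ^ 2 * D ^ 2 * Q + 1 / 8 * ‖zh - z‖ ^ 2 := by
    have hQ : 0 ≤ Q := (sq_nonneg _).trans hΔz
    have n1 : ‖Δ zh - Δ z‖ ≤ Real.sqrt Q * ‖zh - z‖ := by
      refine le_of_sq_le_sq ?_ (by positivity)
      rwa [mul_pow, Real.sq_sqrt hQ]
    have n2 := real_inner_le_norm (Δ zh - Δ z) (u - zh)
    have n3 : ‖Δ zh - Δ z‖ * ‖u - zh‖ ≤ Real.sqrt Q * ‖zh - z‖ * D :=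
      mul_le_mul n1 hD (norm_nonneg _) (by positivity)
    have n4 := mul_le_mul_of_nonneg_left (n2.trans n3) hα
    have n5 : α ^ 2 * D ^ 2 * Q = (α * D * Real.sqrt Q) ^ 2 := by
      rw [mul_pow, mul_pow, Real.sq_sqrt hQ]
    nlinarith [sq_nonneg (2 * (α * D * Real.sqrt Q) - 1 / 2 * ‖zh - z‖)]
  -- The noise is moved from `zh`, which depends on the current sample, to `z`, which does not.
  have e : inner ℝ (F zh + Δ zh) (zh - u) = inner ℝ (F zh) (zh - u)
      - (inner ℝ (Δ zh - Δ z) (u - zh) + inner ℝ (Δ z) (z - zh) + inner ℝ (Δ z) (u - z)) := by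
    simp only [inner_add_left, inner_sub_left, inner_sub_right]
    ring
  rw [e] at hstep
  -- Budget: `y1` to `y3` use 1/4 of ‖zh - z‖², and `y4` and `y5` use 1/8 each, which exhausts the
  -- available 1/2. The noise terms are 4Q from `y1` and `y2`, 2Q from `y4` and 2D²Q from `y5`.
  have y2' := mul_le_mul_of_nonneg_left y2 hα2
  have y6 := mul_le_mul_of_nonneg_left hΔz hα2
  nlinarith

end MirrorProx

/-! ### Control of affine maps by finitely many values -/

section TestPoints

variable {V : Type*} [NormedAddCommGroup V] [NormedSpace ℝ V] [FiniteDimensional ℝ V]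

/-- On a bounded set `Z`, the size and the Lipschitz constant of an affine map are controlled by
its values at finitely many points of `Z`. -/
theorem exists_test_points {Z : Set V} (hZ : Bornology.IsBounded Z) (hne : Z.Nonempty) :
    ∃ (s : Finset V) (B : ℝ), ↑s ⊆ Z ∧ 0 ≤ B ∧
      ∀ (T : V →ᵃ[ℝ] V), ∀ z ∈ Z, ‖T z‖ ^ 2 ≤ B * ∑ p ∈ s, ‖T p‖ ^ 2 ∧
        ∀ z' ∈ Z, ‖T z - T z'‖ ^ 2 ≤ B * (∑ p ∈ s, ‖T p‖ ^ 2) * ‖z - z'‖ ^ 2 := by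
  classical
  obtain ⟨p₀, hp₀⟩ := hne
  -- `Z` may lie in a proper affine subspace, so a basis is taken only for the span of Z - p₀. It
  -- consists of differences z - p₀, so that the test points p₀ and i + p₀ belong to `Z`.
  obtain ⟨b, hbs, hspan, hli⟩ := exists_linearIndependent ℝ ((fun z => z - p₀) '' Z)
  have hbf : Finite b := hli.finite
  have : Fintype b := Fintype.ofFinite b
  have hr : Submodule.span ℝ (Set.range (Subtype.val : b → V))
      = Submodule.span ℝ ((fun z => z - p₀) '' Z) := by
    rw [Subtype.range_coe, hspan]
  let e := Module.Basis.span hli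
  have he : ∀ i, ((e i : Submodule.span ℝ (Set.range (Subtype.val : b → V))) : V) = i :=
    fun i => congrArg Subtype.val (Module.Basis.span_apply hli i)
  let φ : b → (Submodule.span ℝ (Set.range (Subtype.val : b → V))) →L[ℝ] ℝ :=
    fun i => LinearMap.toContinuousLinearMap (e.coord i)
  let κ : ℝ := ∑ i, ‖φ i‖
  have hκ0 : 0 ≤ κ := Finset.sum_nonneg fun i _ => norm_nonneg (φ i)
  have hmem : ∀ i : b, (i : V) + p₀ ∈ Z := by
    intro i
    obtain ⟨z, hz, h⟩ := hbs i.2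
    simp only at h
    rw [← h]
    simpa using hz
  let s : Finset V := insert p₀ (Finset.univ.image fun i : b => (i : V) + p₀)
  obtain ⟨R, hR⟩ := hZ.exists_norm_le
  have hRn : 0 ≤ R := (norm_nonneg _).trans (hR p₀ hp₀)
  -- the estimate before squaring
  have main : ∀ (T : V →ᵃ[ℝ] V) (m : ℝ), (∀ p ∈ s, ‖T p‖ ≤ m) → ∀ z ∈ Z, ∀ z' ∈ Z,
      ‖T z - T z'‖ ≤ κ * (2 * m) * ‖z - z'‖ := by
    intro T m hm z hz z' hz'
    have hin : z - z' ∈ Submodule.span ℝ (Set.range (Subtype.val : b → V)) := by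
      rw [hr]
      have h1 := Submodule.subset_span (R := ℝ) (Set.mem_image_of_mem (fun z => z - p₀) hz)
      have h2 := Submodule.subset_span (R := ℝ) (Set.mem_image_of_mem (fun z => z - p₀) hz')
      have := Submodule.sub_mem _ h1 h2
      simpa using this
    have hrep : z - z' = ∑ i, φ i ⟨z - z', hin⟩ • (i : V) := by
      have := congrArg Subtype.val (e.sum_repr ⟨z - z', hin⟩)
      rw [AddSubmonoidClass.coe_finsetSum] at this
      simp only [Submodule.coe_smul, he] at this
      exact this.symm
    have hlin : T z - T z' = ∑ i : b, φ i ⟨z - z', hin⟩ • T.linear (i : V) := by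
      have h0 : T z - T z' = T.linear (z - z') := by
        simpa using (T.linearMap_vsub z z').symm
      rw [h0]
      nth_rewrite 1 [hrep]
      rw [map_sum]
      simp only [map_smul]
    have hTi : ∀ i : b, ‖T.linear (i : V)‖ ≤ 2 * m := by
      intro i
      have h0 : T.linear (i : V) = T ((i : V) + p₀) - T p₀ := by
        have := T.linearMap_vsub ((i : V) + p₀) p₀
        simpa using this
      rw [h0]
      have h1 := hm ((i : V) + p₀) (by simp [s])
      have h2 := hm p₀ (by simp [s])
      linarith [norm_sub_le (T ((i : V) + p₀)) (T p₀)]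
    rw [hlin]
    calc ‖∑ i : b, φ i ⟨z - z', hin⟩ • T.linear (i : V)‖
        ≤ ∑ i : b, ‖φ i‖ * ‖z - z'‖ * (2 * m) := by
          refine norm_sum_le_of_le _ fun i _ => ?_
          rw [norm_smul]
          refine mul_le_mul ?_ (hTi i) (norm_nonneg _) (by positivity)
          simpa using (φ i).le_opNorm ⟨z - z', hin⟩
      _ = κ * (2 * m) * ‖z - z'‖ := by
          simp only [κ, Finset.sum_mul]
          exact Finset.sum_congr rfl fun i _ => by ring
  -- The first summand serves the Lipschitz bound. The second serves the size bound, which goes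
  -- through p₀ at distance at most 2R.
  refine ⟨s, 4 * κ ^ 2 + (1 + κ * 2 * (2 * R)) ^ 2, ?_, by positivity, ?_⟩
  · intro p hp
    simp only [s, Finset.coe_insert, Finset.coe_image, Finset.coe_univ, Set.image_univ,
      Set.mem_insert_iff, Set.mem_range] at hp
    rcases hp with rfl | ⟨i, rfl⟩
    · exact hp₀
    · exact hmem i
  · intro T z hz
    set W := ∑ p ∈ s, ‖T p‖ ^ 2 with hW
    have hW0 : 0 ≤ W := Finset.sum_nonneg fun p _ => by positivity
    have hm : ∀ p ∈ s, ‖T p‖ ≤ Real.sqrt W := fun p hp =>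
      Real.le_sqrt_of_sq_le
        (Finset.single_le_sum (f := fun p => ‖T p‖ ^ 2) (fun p _ => by positivity) hp)
    have hsq := Real.sq_sqrt hW0
    refine ⟨?_, fun z' hz' => ?_⟩
    · have h1 := main T _ hm z hz p₀ hp₀
      have h2 := hm p₀ (by simp [s])
      have h3 : ‖z - p₀‖ ≤ 2 * R := by linarith [norm_sub_le z p₀, hR z hz, hR p₀ hp₀]
      have h4 : ‖T z‖ ≤ (1 + κ * 2 * (2 * R)) * Real.sqrt W := by
        have h5 := norm_add_le (T z - T p₀) (T p₀)
        rw [sub_add_cancel] at h5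
        have h6 : κ * (2 * Real.sqrt W) * ‖z - p₀‖ ≤ κ * (2 * Real.sqrt W) * (2 * R) := by gcongr
        nlinarith
      have h7 := pow_le_pow_left₀ (norm_nonneg _) h4 2
      rw [mul_pow, hsq] at h7
      nlinarith [mul_nonneg (sq_nonneg κ) hW0]
    · have h1 := pow_le_pow_left₀ (norm_nonneg _) (main T _ hm z hz z' hz') 2
      have h2 : (κ * (2 * Real.sqrt W) * ‖z - z'‖) ^ 2 = 4 * κ ^ 2 * W * ‖z - z'‖ ^ 2 := by
        rw [mul_pow, mul_pow, mul_pow, hsq]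
        ring
      rw [h2] at h1
      have h3 : 0 ≤ (1 + κ * 2 * (2 * R)) ^ 2 * W * ‖z - z'‖ ^ 2 := by positivity
      nlinarith

end TestPoints

/-- The primal-dual space with its Euclidean norm. -/
abbrev Pair (d : ℕ) : Type := WithLp 2 (Vec d × Vec d)

/-- The feasible primal-dual pairs. -/
def feasible {d : ℕ} (X Y : Set (Vec d)) : Set (Pair d) := {z | z.fst ∈ X ∧ z.snd ∈ Y}

/-! ### The saddle-point problem, its monotone operator and the MSPBE -/

section Objective

variable {S : Type*} [Fintype S] [DecidableEq S] {d : ℕ} (M : MRP S) (Φ : Matrix S (Fin d) ℝ)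
  (ξ : S → ℝ)

theorem K_eq (θ : Vec d) :
    K M Φ ξ θ = K M Φ ξ 0 - Matrix.toEuclideanCLM (𝕜 := ℝ) (coupling M Φ ξ) θ := by
  apply WithLp.ofLp_injective
  rw [WithLp.ofLp_sub, Matrix.ofLp_toEuclideanCLM]
  simp only [K, bellman, value, coupling, WithLp.ofLp_zero, Matrix.mulVec_zero, smul_zero,
    sub_zero, add_zero]
  simp only [← Matrix.mulVec_mulVec, Matrix.sub_mulVec, Matrix.smul_mulVec, ← Matrix.mulVec_sub]
  congr 2
  abel

theorem K_sub (θ θ' : Vec d) :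
    K M Φ ξ θ - K M Φ ξ θ' = -Matrix.toEuclideanCLM (𝕜 := ℝ) (coupling M Φ ξ) (θ - θ') := by
  rw [K_eq M Φ ξ θ, K_eq M Φ ξ θ', map_sub]
  abel

theorem inner_toEuclideanCLM_transpose (A : Matrix (Fin d) (Fin d) ℝ) (v w : Vec d) :
    (inner ℝ (Matrix.toEuclideanCLM (𝕜 := ℝ) Aᵀ v) w : ℝ)
      = inner ℝ v (Matrix.toEuclideanCLM (𝕜 := ℝ) A w) := by
  rw [real_inner_comm, Matrix.inner_toEuclideanCLM, Matrix.inner_toEuclideanCLM,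
    Matrix.mulVec_transpose, dotProduct_comm, Matrix.dotProduct_mulVec]

theorem norm_toEuclideanCLM_transpose (A : Matrix (Fin d) (Fin d) ℝ) :
    ‖Matrix.toEuclideanCLM (𝕜 := ℝ) Aᵀ‖ = ‖Matrix.toEuclideanCLM (𝕜 := ℝ) A‖ := by
  rw [← Matrix.conjTranspose_eq_transpose_of_trivial, ← Matrix.star_eq_conjTranspose, map_star,
    ContinuousLinearMap.star_eq_adjoint, LinearIsometryEquiv.norm_map]

theorem gram_transpose : (gram Φ ξ)ᵀ = gram Φ ξ := by
  simp [gram, Matrix.transpose_mul, Matrix.mul_assoc]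

theorem inner_gram_comm (v w : Vec d) :
    (inner ℝ (Matrix.toEuclideanCLM (𝕜 := ℝ) (gram Φ ξ) v) w : ℝ)
      = inner ℝ v (Matrix.toEuclideanCLM (𝕜 := ℝ) (gram Φ ξ) w) := by
  rw [← inner_toEuclideanCLM_transpose, gram_transpose]

variable {ξ}

theorem inner_gram_nonneg (hξ : IsPosDistribution ξ) (w : Vec d) :
    0 ≤ (inner ℝ w (Matrix.toEuclideanCLM (𝕜 := ℝ) (gram Φ ξ) w) : ℝ) := by
  rw [Matrix.inner_toEuclideanCLM, gram, ← Matrix.mulVec_mulVec, ← Matrix.mulVec_mulVec,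
    Matrix.dotProduct_mulVec, Matrix.vecMul_transpose, dotProduct]
  refine Finset.sum_nonneg fun s _ => ?_
  rw [Matrix.mulVec_diagonal]
  have := (hξ.pos s).le
  nlinarith [mul_nonneg this (mul_self_nonneg ((Φ *ᵥ w.ofLp) s))]

/-- `F*` lies above its tangents. -/
theorem Fstar_sub_le (hξ : IsPosDistribution ξ) (v w : Vec d) :
    Fstar Φ ξ v - Fstar Φ ξ w
      ≤ inner ℝ (Matrix.toEuclideanCLM (𝕜 := ℝ) (gram Φ ξ) v) (v - w) := by
  have h := inner_gram_nonneg Φ hξ (v - w)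
  have h1 := inner_gram_comm Φ ξ v w
  have h2 := inner_gram_comm Φ ξ w v
  have h3 := inner_gram_comm Φ ξ v v
  rw [real_inner_comm] at h2
  simp only [Fstar, map_sub, inner_sub_left, inner_sub_right] at *
  linarith

/-- The tangent inequalities at the convex combination are averaged; their linear terms cancel. -/
theorem convexOn_Fstar (hξ : IsPosDistribution ξ) : ConvexOn ℝ Set.univ (Fstar Φ ξ) := by
  refine ⟨convex_univ, fun v _ w _ a b ha hb hab => ?_⟩
  have h1 := Fstar_sub_le Φ hξ (a • v + b • w) v
  have h2 := Fstar_sub_le Φ hξ (a • v + b • w) w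
  set g := Matrix.toEuclideanCLM (𝕜 := ℝ) (gram Φ ξ) (a • v + b • w)
  have h3 : a * inner ℝ g (a • v + b • w - v) + b * inner ℝ g (a • v + b • w - w) = (0 : ℝ) := by
    rw [← real_inner_smul_right, ← real_inner_smul_right, ← inner_add_right]
    have : a • (a • v + b • w - v) + b • (a • v + b • w - w) = (0 : Vec d) := by
      obtain rfl : b = 1 - a := by linarith
      module
    rw [this, inner_zero_right]
  simp only [smul_eq_mul]
  have h1' := mul_le_mul_of_nonneg_left h1 ha
  have h2' := mul_le_mul_of_nonneg_left h2 hb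
  have h4 : Fstar Φ ξ (a • v + b • w) = a * Fstar Φ ξ (a • v + b • w)
      + b * Fstar Φ ξ (a • v + b • w) := by rw [← add_mul, hab, one_mul]
  linarith

variable (ξ)

/-- The monotone operator `(-Aᵀ w, G w - K(θ))` of the saddle-point problem. -/
noncomputable def field (z : Pair d) : Pair d :=
  WithLp.toLp 2 (-Matrix.toEuclideanCLM (𝕜 := ℝ) (coupling M Φ ξ)ᵀ z.snd,
    Matrix.toEuclideanCLM (𝕜 := ℝ) (gram Φ ξ) z.snd - K M Φ ξ z.fst)

theorem field_sub (z z' : Pair d) : field M Φ ξ z - field M Φ ξ z' =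
    WithLp.toLp 2 (-Matrix.toEuclideanCLM (𝕜 := ℝ) (coupling M Φ ξ)ᵀ (z - z').snd,
      Matrix.toEuclideanCLM (𝕜 := ℝ) (gram Φ ξ) (z - z').snd
        + Matrix.toEuclideanCLM (𝕜 := ℝ) (coupling M Φ ξ) (z - z').fst) := by
  have h := K_sub M Φ ξ z.fst z'.fst
  rw [field, field, ← WithLp.toLp_sub, Prod.mk_sub_mk, WithLp.sub_snd, WithLp.sub_fst,
    map_sub (Matrix.toEuclideanCLM (𝕜 := ℝ) (coupling M Φ ξ)ᵀ),
    map_sub (Matrix.toEuclideanCLM (𝕜 := ℝ) (gram Φ ξ)),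
    ← neg_neg (Matrix.toEuclideanCLM (𝕜 := ℝ) (coupling M Φ ξ) (z.fst - z'.fst)), ← h]
  congr 2 <;> abel

theorem norm_field_sub_le (z z' : Pair d) :
    ‖field M Φ ξ z - field M Φ ξ z'‖ ≤ (lipF Φ ξ + lipK M Φ ξ) * ‖z - z'‖ := by
  have hG : 0 ≤ lipF Φ ξ := norm_nonneg _
  have hA : 0 ≤ lipK M Φ ξ := norm_nonneg _
  rw [field_sub]
  set v := z - z'
  refine le_of_sq_le_sq ?_ (by positivity)
  rw [mul_pow, WithLp.prod_norm_sq_eq_of_L2, WithLp.prod_norm_sq_eq_of_L2 v]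
  simp only [WithLp.toLp_fst, WithLp.toLp_snd, norm_neg]
  have h1 : ‖Matrix.toEuclideanCLM (𝕜 := ℝ) (coupling M Φ ξ)ᵀ v.snd‖ ≤ lipK M Φ ξ * ‖v.snd‖ := by
    rw [lipK, ← norm_toEuclideanCLM_transpose]
    exact ContinuousLinearMap.le_opNorm _ _
  have h2 : ‖Matrix.toEuclideanCLM (𝕜 := ℝ) (gram Φ ξ) v.snd
      + Matrix.toEuclideanCLM (𝕜 := ℝ) (coupling M Φ ξ) v.fst‖
      ≤ lipF Φ ξ * ‖v.snd‖ + lipK M Φ ξ * ‖v.fst‖ :=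
    (norm_add_le _ _).trans
      (add_le_add (ContinuousLinearMap.le_opNorm _ _) (ContinuousLinearMap.le_opNorm _ _))
  have h1' := pow_le_pow_left₀ (norm_nonneg _) h1 2
  have h2' := pow_le_pow_left₀ (norm_nonneg _) h2 2
  nlinarith [mul_nonneg (mul_nonneg hG hA) (sq_nonneg (‖v.snd‖ - ‖v.fst‖)),
    mul_nonneg (mul_nonneg hG hA) (sq_nonneg ‖v.snd‖),
    mul_nonneg (mul_nonneg hG hA) (sq_nonneg ‖v.fst‖),
    mul_nonneg (mul_nonneg hG hG) (sq_nonneg ‖v.fst‖)]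

variable {ξ}

/-- Regret of `z` against `u` in the saddle-point problem, linearized at `z`. -/
theorem saddle_sub_le (hξ : IsPosDistribution ξ) (h : Vec d → ℝ) (z u : Pair d) :
    saddle M Φ ξ h z.fst u.snd - saddle M Φ ξ h u.fst z.snd
      ≤ inner ℝ (field M Φ ξ z) (z - u) + (h z.fst - h u.fst) := by
  have h1 := Fstar_sub_le Φ hξ z.snd u.snd
  -- `K` is affine, so the coupling contributes exactly; inequality comes only from the convexity of
  -- `F*`.
  have h2 : (inner ℝ (-Matrix.toEuclideanCLM (𝕜 := ℝ) (coupling M Φ ξ)ᵀ z.snd)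
      (z.fst - u.fst) : ℝ) = inner ℝ (K M Φ ξ z.fst - K M Φ ξ u.fst) z.snd := by
    rw [K_sub, inner_neg_left, inner_neg_left, inner_toEuclideanCLM_transpose, real_inner_comm]
  simp only [field, saddle, WithLp.prod_inner_apply, WithLp.ofLp_sub, Prod.fst_sub, Prod.snd_sub,
    WithLp.ofLp_fst, WithLp.ofLp_snd]
  rw [h2]
  simp only [inner_sub_left, inner_sub_right] at *
  linarith

theorem convexOn_saddle {h : Vec d → ℝ} {X : Set (Vec d)} (hh : ConvexOn ℝ X h) (w : Vec d) :
    ConvexOn ℝ X fun θ => saddle M Φ ξ h θ w := by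
  refine ⟨hh.1, fun a ha b hb p q hp hq hpq => ?_⟩
  have h1 := hh.2 ha hb hp hq hpq
  have e : K M Φ ξ (p • a + q • b) = p • K M Φ ξ a + q • K M Φ ξ b := by
    rw [K_eq M Φ ξ (p • a + q • b), K_eq M Φ ξ a, K_eq M Φ ξ b, map_add, map_smul, map_smul]
    obtain rfl : q = 1 - p := by linarith
    module
  simp only [saddle, smul_eq_mul, e, inner_add_left, real_inner_smul_left] at *
  have h4 : Fstar Φ ξ w = p * Fstar Φ ξ w + q * Fstar Φ ξ w := by rw [← add_mul, hpq, one_mul]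
  linarith

theorem convexOn_neg_saddle (hξ : IsPosDistribution ξ) (h : Vec d → ℝ) {Y : Set (Vec d)}
    (hY : Convex ℝ Y) (θ : Vec d) : ConvexOn ℝ Y fun w => -saddle M Φ ξ h θ w := by
  refine ⟨hY, fun a _ b _ p q hp hq hpq => ?_⟩
  have h1 := (convexOn_Fstar Φ hξ).2 (Set.mem_univ a) (Set.mem_univ b) hp hq hpq
  simp only [saddle, smul_eq_mul, inner_add_right, real_inner_smul_right] at *
  have h4 : h θ = p * h θ + q * h θ := by rw [← add_mul, hpq, one_mul]
  linarith

theorem continuous_K : Continuous (K M Φ ξ) := by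
  have : K M Φ ξ = fun θ => K M Φ ξ 0 - Matrix.toEuclideanCLM (𝕜 := ℝ) (coupling M Φ ξ) θ :=
    funext fun θ => K_eq M Φ ξ θ
  rw [this]
  fun_prop

theorem continuous_Fstar : Continuous (Fstar Φ ξ) := by
  unfold Fstar
  fun_prop

/-- The objective `½ MSPBE(θ)` is `½ K(θ)ᵀ G⁻¹ K(θ)`. -/
theorem mspbe_eq (hG : IsUnit (gram Φ ξ).det) (θ : Vec d) :
    mspbe M Φ ξ θ
      = inner ℝ (K M Φ ξ θ) (Matrix.toEuclideanCLM (𝕜 := ℝ) (gram Φ ξ)⁻¹ (K M Φ ξ θ)) := by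
  set e : S → ℝ := bellman M (value Φ θ) - value Φ θ with he
  set G := gram Φ ξ with hGdef
  have hK : K M Φ ξ θ = WithLp.toLp 2 (Φᵀ *ᵥ (Matrix.diagonal ξ *ᵥ e)) := rfl
  set k : Fin d → ℝ := Φᵀ *ᵥ (Matrix.diagonal ξ *ᵥ e) with hk
  -- V_θ lies in the range of the projection, so the projected Bellman error is the projection of
  -- TV_θ - V_θ, up to sign.
  have hfix : projMatrix Φ ξ *ᵥ value Φ θ = value Φ θ := by
    rw [projMatrix, value, Matrix.mulVec_mulVec, Matrix.mul_assoc, Matrix.mul_assoc,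
      Matrix.mul_assoc Φ]
    rw [← Matrix.mul_assoc Φᵀ, ← gram, Matrix.nonsing_inv_mul _ hG, Matrix.mul_one]
  have hproj : projMatrix Φ ξ *ᵥ e = Φ *ᵥ (G⁻¹ *ᵥ k) := by
    rw [projMatrix, hk]
    simp only [Matrix.mulVec_mulVec, Matrix.mul_assoc]
    rfl
  have hdiff : ∀ s, value Φ θ s - (projMatrix Φ ξ *ᵥ bellman M (value Φ θ)) s
      = -(Φ *ᵥ (G⁻¹ *ᵥ k)) s := by
    intro s
    rw [← hproj, he, Matrix.mulVec_sub, hfix, Pi.sub_apply]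
    ring
  have h1 : mspbe M Φ ξ θ = (G⁻¹ *ᵥ k) ⬝ᵥ (G *ᵥ (G⁻¹ *ᵥ k)) := by
    rw [hGdef, gram, ← Matrix.mulVec_mulVec, ← Matrix.mulVec_mulVec, Matrix.dotProduct_mulVec,
      Matrix.vecMul_transpose, ← gram, ← hGdef, mspbe, dotProduct]
    refine Finset.sum_congr rfl fun s _ => ?_
    rw [hdiff, Matrix.mulVec_diagonal]
    ring
  rw [h1, Matrix.mulVec_mulVec k, Matrix.mul_nonsing_inv _ hG, Matrix.one_mulVec, hK,
    Matrix.inner_toEuclideanCLM, dotProduct_comm]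

theorem gram_apply_inv (hG : IsUnit (gram Φ ξ).det) (v : Vec d) :
    Matrix.toEuclideanCLM (𝕜 := ℝ) (gram Φ ξ)
      (Matrix.toEuclideanCLM (𝕜 := ℝ) (gram Φ ξ)⁻¹ v) = v := by
  rw [← mul_apply_eq_comp, ← map_mul, Matrix.mul_nonsing_inv _ hG, map_one]
  rfl

/-- At the dual maximizer Gw = K(θ), so `F*` takes away exactly half of ⟨K(θ), w⟩. -/
theorem half_mspbe_eq_saddle (hG : IsUnit (gram Φ ξ).det) (h : Vec d → ℝ) (θ : Vec d) :
    1 / 2 * mspbe M Φ ξ θ + h θ = saddle M Φ ξ h θ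
      (Matrix.toEuclideanCLM (𝕜 := ℝ) (gram Φ ξ)⁻¹ (K M Φ ξ θ)) := by
  set w := Matrix.toEuclideanCLM (𝕜 := ℝ) (gram Φ ξ)⁻¹ (K M Φ ξ θ) with hw
  have h1 : Matrix.toEuclideanCLM (𝕜 := ℝ) (gram Φ ξ) w = K M Φ ξ θ := gram_apply_inv Φ hG _
  rw [mspbe_eq M Φ hG, ← hw, saddle, Fstar, h1, real_inner_comm w]
  ring

/-- The gradient of `F*` at w' = G⁻¹K(θ) is K(θ), so the tangent inequality there makes w' a global
maximizer of the loss in w. -/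
theorem saddle_le_half_mspbe (hξ : IsPosDistribution ξ) (hG : IsUnit (gram Φ ξ).det)
    (h : Vec d → ℝ) (θ w : Vec d) :
    saddle M Φ ξ h θ w ≤ 1 / 2 * mspbe M Φ ξ θ + h θ := by
  rw [half_mspbe_eq_saddle M Φ hG]
  set w' := Matrix.toEuclideanCLM (𝕜 := ℝ) (gram Φ ξ)⁻¹ (K M Φ ξ θ) with hw
  have h1 : Matrix.toEuclideanCLM (𝕜 := ℝ) (gram Φ ξ) w' = K M Φ ξ θ := gram_apply_inv Φ hG _
  have h2 := Fstar_sub_le Φ hξ w' w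
  rw [h1, inner_sub_right] at h2
  simp only [saddle]
  linarith

end Objective

/-! ### The stochastic oracle and its affine noise -/

section Oracle

variable {S : Type*} {d : ℕ}

/-- The stochastic oracle for the monotone operator `field`. -/
noncomputable def oracle (γ : ℝ) (Φ : Matrix S (Fin d) ℝ) (x : S × ℝ × S) (z : Pair d) : Pair d :=
  WithLp.toLp 2 (oracleKT γ Φ x z.snd, oracleF Φ x z.snd - oracleK γ Φ x z.fst)

/-- The linear part of the affine map `oracle γ Φ x`. -/
noncomputable def oracleLin (γ : ℝ) (Φ : Matrix S (Fin d) ℝ) (x : S × ℝ × S) :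
    Pair d →ₗ[ℝ] Pair d where
  toFun v := WithLp.toLp 2 (oracleKT γ Φ x v.snd, oracleF Φ x v.snd
    - (γ * inner ℝ (feat Φ x.2.2) v.fst - inner ℝ (feat Φ x.1) v.fst : ℝ) • feat Φ x.1)
  map_add' v w := by
    simp only [oracleKT, oracleF, WithLp.add_snd, WithLp.add_fst, inner_add_right,
      ← WithLp.toLp_add, Prod.mk_add_mk]
    congr 2 <;> module
  map_smul' r v := by
    simp only [oracleKT, oracleF, WithLp.smul_snd, WithLp.smul_fst, real_inner_smul_right,
      ← WithLp.toLp_smul, Prod.smul_mk, RingHom.id_apply]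
    congr 2 <;> module

theorem oracle_sub (γ : ℝ) (Φ : Matrix S (Fin d) ℝ) (x : S × ℝ × S) (z z' : Pair d) :
    oracle γ Φ x z - oracle γ Φ x z' = oracleLin γ Φ x (z - z') := by
  simp only [oracle, oracleLin, LinearMap.coe_mk, AddHom.coe_mk, oracleKT, oracleF, oracleK,
    tdError, WithLp.sub_snd, WithLp.sub_fst, inner_sub_right, ← WithLp.toLp_sub, Prod.mk_sub_mk]
  congr 2 <;> module

variable [Fintype S] [DecidableEq S] (M : MRP S) (Φ : Matrix S (Fin d) ℝ) (ξ : S → ℝ)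

/-- The linear part of the affine map `field M Φ ξ`. -/
noncomputable def fieldLin : Pair d →ₗ[ℝ] Pair d where
  toFun v := WithLp.toLp 2 (-Matrix.toEuclideanCLM (𝕜 := ℝ) (coupling M Φ ξ)ᵀ v.snd,
    Matrix.toEuclideanCLM (𝕜 := ℝ) (gram Φ ξ) v.snd
      + Matrix.toEuclideanCLM (𝕜 := ℝ) (coupling M Φ ξ) v.fst)
  map_add' v w := by
    simp only [WithLp.add_snd, WithLp.add_fst, map_add, ← WithLp.toLp_add, Prod.mk_add_mk]
    congr 2 <;> abel
  map_smul' r v := by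
    simp only [WithLp.smul_snd, WithLp.smul_fst, map_smul, ← WithLp.toLp_smul, Prod.smul_mk,
      RingHom.id_apply, smul_add, smul_neg]

/-- The noise of the stochastic oracle on the sample `x`, an affine map of the query point. -/
noncomputable def noise (x : S × ℝ × S) : Pair d →ᵃ[ℝ] Pair d where
  toFun z := oracle M.γ Φ x z - field M Φ ξ z
  linear := oracleLin M.γ Φ x - fieldLin M Φ ξ
  map_vadd' p v := by
    have h1 := oracle_sub M.γ Φ x (v + p) p
    have h2 : field M Φ ξ (v + p) - field M Φ ξ p = fieldLin M Φ ξ (v + p - p) :=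
      field_sub M Φ ξ (v + p) p
    rw [add_sub_cancel_right] at h1 h2
    rw [vadd_eq_add, vadd_eq_add, LinearMap.sub_apply, ← h1, ← h2]
    abel

theorem noise_apply (x : S × ℝ × S) (z : Pair d) :
    noise M Φ ξ x z = oracle M.γ Φ x z - field M Φ ξ z := rfl

end Oracle

/-! ### The algorithm on the Euclidean product space -/

section Step

variable {S : Type*} {d : ℕ} {X Y : Set (Vec d)} {h : Vec d → ℝ}

/-- `proxStep` with equal stepsizes, on the Euclidean product space. -/
noncomputable def step (X Y : Set (Vec d)) (h : Vec d → ℝ) (γ : ℝ) (Φ : Matrix S (Fin d) ℝ)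
    (a : ℝ) (x : S × ℝ × S) (z g : Pair d) : Pair d :=
  WithLp.toLp 2 (proxStep X Y h γ Φ a a x z.ofLp g.ofLp)

/-- The iterates of GTD2-MP with constant stepsize, on the Euclidean product space. -/
noncomputable def path (X Y : Set (Vec d)) (h : Vec d → ℝ) (γ : ℝ) (Φ : Matrix S (Fin d) ℝ)
    (a : ℝ) (x : ℕ → S × ℝ × S) (z₀ : Vec d × Vec d) (t : ℕ) : Pair d :=
  WithLp.toLp 2 (iter X Y h γ Φ (fun _ => a) (fun _ => a) x z₀ t)

/-- The extragradient points of GTD2-MP with constant stepsize. -/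
noncomputable def halfPath (X Y : Set (Vec d)) (h : Vec d → ℝ) (γ : ℝ) (Φ : Matrix S (Fin d) ℝ)
    (a : ℝ) (x : ℕ → S × ℝ × S) (z₀ : Vec d × Vec d) (t : ℕ) : Pair d :=
  WithLp.toLp 2 (halfIter X Y h γ Φ (fun _ => a) (fun _ => a) x z₀ t)

variable {γ : ℝ} {Φ : Matrix S (Fin d) ℝ} {a : ℝ}

theorem halfPath_eq (x : ℕ → S × ℝ × S) (z₀ : Vec d × Vec d) (t : ℕ) :
    halfPath X Y h γ Φ a x z₀ t
      = step X Y h γ Φ a (x t) (path X Y h γ Φ a x z₀ t) (path X Y h γ Φ a x z₀ t) := rfl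

theorem path_succ (x : ℕ → S × ℝ × S) (z₀ : Vec d × Vec d) (t : ℕ) :
    path X Y h γ Φ a x z₀ (t + 1)
      = step X Y h γ Φ a (x t) (path X Y h γ Φ a x z₀ t) (halfPath X Y h γ Φ a x z₀ t) := rfl

/-- The prox problems of GTD2-MP are well posed. -/
structure Admissible (X Y : Set (Vec d)) (h : Vec d → ℝ) : Prop where
  compactX : IsCompact X
  nonemptyX : X.Nonempty
  compactY : IsCompact Y
  convexY : Convex ℝ Y
  nonemptyY : Y.Nonempty
  convexOn : ConvexOn ℝ X h
  continuousOn : ContinuousOn h X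

namespace Admissible

theorem convexOn_mul (H : Admissible X Y h) (ha : 0 ≤ a) : ConvexOn ℝ X fun u => a * h u :=
  H.convexOn.smul ha

theorem continuousOn_mul (H : Admissible X Y h) (a : ℝ) : ContinuousOn (fun u => a * h u) X :=
  continuousOn_const.mul H.continuousOn

theorem isCompact_feasible (H : Admissible X Y h) : IsCompact (feasible X Y) := by
  have h1 := (H.compactX.prod H.compactY).image
    (WithLp.prod_continuous_toLp 2 (Vec d) (Vec d))
  convert h1
  ext z
  constructor
  · intro hz
    exact ⟨z.ofLp, ⟨hz.1, hz.2⟩, rfl⟩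
  · rintro ⟨p, hp, rfl⟩
    exact ⟨hp.1, hp.2⟩

theorem step_mem (H : Admissible X Y h) (x : S × ℝ × S) (z g : Pair d) :
    step X Y h γ Φ a x z g ∈ feasible X Y :=
  ⟨(prox_spec H.compactX H.nonemptyX (H.continuousOn_mul a) _).1,
    (prox_spec H.compactY H.nonemptyY continuousOn_const _).1⟩

theorem halfPath_mem (H : Admissible X Y h) (x : ℕ → S × ℝ × S) (z₀ : Vec d × Vec d) (t : ℕ) :
    halfPath X Y h γ Φ a x z₀ t ∈ feasible X Y := H.step_mem _ _ _

theorem path_mem (H : Admissible X Y h) (x : ℕ → S × ℝ × S) {z₀ : Vec d × Vec d}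
    (hz₀ : WithLp.toLp 2 z₀ ∈ feasible X Y) (t : ℕ) :
    path X Y h γ Φ a x z₀ t ∈ feasible X Y := by
  cases t with
  | zero => exact hz₀
  | succ t => exact H.step_mem _ _ _

/-- Since both stepsizes equal `a`, the inequalities of the two blocks add up to that of a single
proximal step for `oracle` on the product space. -/
theorem step_variational (H : Admissible X Y h) (ha : 0 ≤ a) (x : S × ℝ × S) (z g : Pair d)
    {u : Pair d} (hu : u ∈ feasible X Y) :
    a * h (step X Y h γ Φ a x z g).fst - a * h u.fst
      ≤ inner ℝ (step X Y h γ Φ a x z g - z + a • oracle γ Φ x g)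
          (u - step X Y h γ Φ a x z g) := by
  have h1 := prox_variational H.compactX H.nonemptyX (H.continuousOn_mul a) (H.convexOn_mul ha)
    (z.fst + (a * inner ℝ (feat Φ x.1) g.snd) • (feat Φ x.1 - γ • feat Φ x.2.2)) hu.1
  have h2 := prox_variational (f := fun _ => 0) H.compactY H.nonemptyY continuousOn_const
    (convexOn_const 0 H.convexY)
    (z.snd + (a * (tdError γ Φ x g.fst - inner ℝ (feat Φ x.1) g.snd)) • feat Φ x.1) hu.2
  rw [sub_zero] at h2
  rw [WithLp.prod_inner_apply]
  refine le_trans (le_of_eq ?_) (add_le_add h1 h2)|>.trans (le_of_eq ?_)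
  · rw [add_zero]; rfl
  · congr 1
    · congr 1
      simp only [oracle, oracleKT, WithLp.ofLp_add, WithLp.ofLp_sub, WithLp.ofLp_smul,
        Prod.fst_add, Prod.fst_sub, Prod.smul_fst, step, proxStep, WithLp.ofLp_fst,
        WithLp.ofLp_snd]
      module
    · congr 1
      simp only [oracle, oracleF, oracleK, WithLp.ofLp_add, WithLp.ofLp_sub, WithLp.ofLp_smul,
        Prod.snd_add, Prod.snd_sub, Prod.smul_snd, step, proxStep, WithLp.ofLp_fst,
        WithLp.ofLp_snd]
      module

theorem average_mem (H : Admissible X Y h) (x : ℕ → S × ℝ × S) (z₀ : Vec d × Vec d) {N : ℕ}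
    (hN : 1 ≤ N) : average X Y h γ Φ (fun _ => a) (fun _ => a) x z₀ N ∈ X ×ˢ Y := by
  have hN0 : (0 : ℝ) < N := by exact_mod_cast hN
  rw [average, Finset.smul_sum]
  refine (H.convexOn.1.prod H.convexY).sum_mem (fun _ _ => by positivity) ?_ fun t _ => ?_
  · rw [Finset.sum_const, Finset.card_range, nsmul_eq_mul, mul_inv_cancel₀ hN0.ne']
  · exact H.halfPath_mem x z₀ t

variable [Fintype S] [MeasurableSpace S] [MeasurableSingletonClass S]

theorem measurable_step (H : Admissible X Y h) (ha : 0 ≤ a) :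
    Measurable fun q : (S × ℝ × S) × Pair d × Pair d => step X Y h γ Φ a q.1 q.2.1 q.2.2 := by
  have m1 : Measurable fun q : (S × ℝ × S) × Pair d × Pair d => feat Φ q.1.1 :=
    (Measurable.of_discrete (f := feat Φ)).comp (by fun_prop)
  have m2 : Measurable fun q : (S × ℝ × S) × Pair d × Pair d => feat Φ q.1.2.2 :=
    (Measurable.of_discrete (f := feat Φ)).comp (by fun_prop)
  have c1 : Continuous fun z : Pair d => z.fst := by fun_prop
  have c2 : Continuous fun z : Pair d => z.snd := by fun_prop
  have z1 : Measurable fun q : (S × ℝ × S) × Pair d × Pair d => q.2.1.fst :=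
    c1.measurable.comp (by fun_prop)
  have z2 : Measurable fun q : (S × ℝ × S) × Pair d × Pair d => q.2.1.snd :=
    c2.measurable.comp (by fun_prop)
  have g1 : Measurable fun q : (S × ℝ × S) × Pair d × Pair d => q.2.2.fst :=
    c1.measurable.comp (by fun_prop)
  have g2 : Measurable fun q : (S × ℝ × S) × Pair d × Pair d => q.2.2.snd :=
    c2.measurable.comp (by fun_prop)
  have p1 := (continuous_prox H.compactX H.nonemptyX (H.continuousOn_mul a)
    (H.convexOn_mul ha)).measurable
  have p2 := (continuous_prox (f := fun _ => 0) H.compactY H.nonemptyY continuousOn_const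
    (convexOn_const 0 H.convexY)).measurable
  refine (WithLp.prod_continuous_toLp 2 (Vec d) (Vec d)).measurable.comp
    (Measurable.prodMk (p1.comp ?_) (p2.comp ?_))
  · exact z1.add (((m1.inner g2).const_mul a).smul (m1.sub (m2.const_smul γ)))
  · refine z2.add ((Measurable.const_mul ?_ a).smul m1)
    unfold tdError
    have mr : Measurable fun q : (S × ℝ × S) × Pair d × Pair d => q.1.2.1 := by fun_prop
    exact ((mr.add ((m2.inner g1).const_mul γ)).sub (m1.inner g1)).sub (m1.inner g2)

end Admissible

end Step

/-! ### The gap bound along a fixed sample path -/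

section Pathwise

variable {S : Type*} [Fintype S] [DecidableEq S] {d : ℕ} {X Y : Set (Vec d)} {h : Vec d → ℝ}
  (M : MRP S) (Φ : Matrix S (Fin d) ℝ) {ξ : S → ℝ} {a : ℝ}

theorem dualityGap_le (hX : X.Nonempty) (hY : Y.Nonempty) {z : Vec d × Vec d} {R : ℝ}
    (hR : ∀ w ∈ Y, ∀ θ ∈ X, saddle M Φ ξ h z.1 w - saddle M Φ ξ h θ z.2 ≤ R) :
    dualityGap M Φ ξ h X Y z ≤ R := by
  rw [dualityGap, sub_le_iff_le_add]
  refine csSup_le (hY.image _) ?_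
  rintro _ ⟨w, hw, rfl⟩
  rw [← sub_le_iff_le_add']
  refine le_csInf (hX.image _) ?_
  rintro _ ⟨θ, hθ, rfl⟩
  have := hR w hw θ hθ
  simp only
  linarith

/-- Jensen's inequality in each variable: the loss is convex in θ and concave in w. -/
theorem saddle_average_le (hξ : IsPosDistribution ξ) (H : Admissible X Y h)
    (x : ℕ → S × ℝ × S) (z₀ : Vec d × Vec d) {N : ℕ} (hN : 1 ≤ N) (θ w : Vec d) :
    saddle M Φ ξ h (average X Y h M.γ Φ (fun _ => a) (fun _ => a) x z₀ N).1 w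
        - saddle M Φ ξ h θ (average X Y h M.γ Φ (fun _ => a) (fun _ => a) x z₀ N).2
      ≤ (N : ℝ)⁻¹ * ∑ t ∈ Finset.range N,
        (saddle M Φ ξ h (halfPath X Y h M.γ Φ a x z₀ t).fst w
          - saddle M Φ ξ h θ (halfPath X Y h M.γ Φ a x z₀ t).snd) := by
  have hN0 : (0 : ℝ) < N := by exact_mod_cast hN
  have hsum : ∑ _t ∈ Finset.range N, (N : ℝ)⁻¹ = 1 := by
    rw [Finset.sum_const, Finset.card_range, nsmul_eq_mul, mul_inv_cancel₀ hN0.ne']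
  have h1 := (convexOn_saddle M Φ (ξ := ξ) H.convexOn w).map_sum_le
    (t := Finset.range N) (w := fun _ => (N : ℝ)⁻¹)
    (p := fun t => (halfPath X Y h M.γ Φ a x z₀ t).fst) (fun _ _ => by positivity) hsum
    (fun t _ => (H.halfPath_mem x z₀ t).1)
  have h2 := (convexOn_neg_saddle M Φ hξ h H.convexY θ).map_sum_le
    (t := Finset.range N) (w := fun _ => (N : ℝ)⁻¹)
    (p := fun t => (halfPath X Y h M.γ Φ a x z₀ t).snd) (fun _ _ => by positivity) hsum
    (fun t _ => (H.halfPath_mem x z₀ t).2)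
  have e1 : (average X Y h M.γ Φ (fun _ => a) (fun _ => a) x z₀ N).1
      = ∑ t ∈ Finset.range N, (N : ℝ)⁻¹ • (halfPath X Y h M.γ Φ a x z₀ t).fst := by
    rw [average, Prod.smul_fst, Prod.fst_sum, Finset.smul_sum]
    rfl
  have e2 : (average X Y h M.γ Φ (fun _ => a) (fun _ => a) x z₀ N).2
      = ∑ t ∈ Finset.range N, (N : ℝ)⁻¹ • (halfPath X Y h M.γ Φ a x z₀ t).snd := by
    rw [average, Prod.smul_snd, Prod.snd_sum, Finset.smul_sum]
    rfl
  rw [← e1] at h1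
  rw [← e2] at h2
  simp only [smul_eq_mul, mul_neg, Finset.sum_neg_distrib] at h1 h2
  rw [Finset.mul_sum]
  simp only [mul_sub, Finset.sum_sub_distrib]
  linarith

/-- The error bound along a sample path. Here `Q x` bounds the noise on the sample `x`. -/
theorem dualityGap_average_le (hξ : IsPosDistribution ξ) (H : Admissible X Y h)
    (ha : 0 < a) (haL : a * (lipF Φ ξ + lipK M Φ ξ) ≤ 1 / 2) {D : ℝ}
    (hD : ∀ u ∈ feasible X Y, ∀ z ∈ feasible X Y, ‖u - z‖ ≤ D) {Q : S × ℝ × S → ℝ}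
    (hQ : ∀ x, ∀ z ∈ feasible X Y, ‖noise M Φ ξ x z‖ ^ 2 ≤ Q x ∧ ∀ z' ∈ feasible X Y,
      ‖noise M Φ ξ x z - noise M Φ ξ x z'‖ ^ 2 ≤ Q x * ‖z - z'‖ ^ 2)
    (x : ℕ → S × ℝ × S) {z₀ : Vec d × Vec d} (hz₀ : WithLp.toLp 2 z₀ ∈ feasible X Y) {N : ℕ}
    (hN : 1 ≤ N) :
    dualityGap M Φ ξ h X Y (average X Y h M.γ Φ (fun _ => a) (fun _ => a) x z₀ N)
      ≤ (a * N)⁻¹ * (1 / 2 * D ^ 2 + a ^ 2 * ((6 + 2 * D ^ 2) * ∑ t ∈ Finset.range N, Q (x t))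
        + a * ∑ t ∈ Finset.range N, inner ℝ (noise M Φ ξ (x t) (path X Y h M.γ Φ a x z₀ t))
            (WithLp.toLp 2 z₀ - path X Y h M.γ Φ a x z₀ t)
        + a * (D * ‖∑ t ∈ Finset.range N,
            noise M Φ ξ (x t) (path X Y h M.γ Φ a x z₀ t)‖)) := by
  have hN0 : (0 : ℝ) < N := by exact_mod_cast hN
  refine dualityGap_le M Φ H.nonemptyX H.nonemptyY fun w hw θ hθ => ?_
  refine (saddle_average_le M Φ hξ H x z₀ hN θ w).trans ?_
  set u : Pair d := WithLp.toLp 2 (θ, w) with hu_def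
  have hu : u ∈ feasible X Y := ⟨hθ, hw⟩
  set z := path X Y h M.γ Φ a x z₀ with hz_def
  set zh := halfPath X Y h M.γ Φ a x z₀ with hzh_def
  have hz : ∀ t, z t ∈ feasible X Y := fun t => H.path_mem x hz₀ t
  have hzh : ∀ t, zh t ∈ feasible X Y := fun t => H.halfPath_mem x z₀ t
  -- The direction u - z_t is split at z₀, so that `u`, over which a supremum is taken before the
  -- expectation, meets the noise only in a fixed direction u - z₀.
  have hone : ∀ t, a * (saddle M Φ ξ h (zh t).fst w - saddle M Φ ξ h θ (zh t).snd)
      ≤ 1 / 2 * ‖z t - u‖ ^ 2 - 1 / 2 * ‖z (t + 1) - u‖ ^ 2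
        + a ^ 2 * ((6 + 2 * D ^ 2) * Q (x t))
        + a * (inner ℝ (noise M Φ ξ (x t) (z t)) (WithLp.toLp 2 z₀ - z t)
          + inner ℝ (noise M Φ ξ (x t) (z t)) (u - WithLp.toLp 2 z₀)) := by
    intro t
    have hor : ∀ p, oracle M.γ Φ (x t) p = field M Φ ξ p + noise M Φ ξ (x t) p := fun p => by
      rw [noise_apply]; abel
    have v1 := H.step_variational (γ := M.γ) (Φ := Φ) ha.le (x t) (z t) (z t) (hz (t + 1))
    have v2 := H.step_variational (γ := M.γ) (Φ := Φ) ha.le (x t) (z t) (zh t) hu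
    rw [← halfPath_eq] at v1
    rw [← path_succ] at v2
    rw [hor] at v1 v2
    have key := noisy_extragradient_step ha.le
      (add_nonneg (norm_nonneg _) (norm_nonneg _)) haL v1 v2
      (norm_field_sub_le M Φ ξ (zh t) (z t)) (hQ (x t) _ (hz t)).1 (hQ (x t) _ (hzh t)).1
      ((hQ (x t) _ (hzh t)).2 _ (hz t)) (hD u hu _ (hzh t))
    have hs := mul_le_mul_of_nonneg_left (saddle_sub_le M Φ hξ h (zh t) u) ha.le
    have e : (inner ℝ (noise M Φ ξ (x t) (z t)) (u - z t) : ℝ)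
        = inner ℝ (noise M Φ ξ (x t) (z t)) (WithLp.toLp 2 z₀ - z t)
          + inner ℝ (noise M Φ ξ (x t) (z t)) (u - WithLp.toLp 2 z₀) := by
      rw [← inner_add_right]; congr 1; abel
    rw [← e]
    simp only [hu_def, WithLp.toLp_fst, WithLp.toLp_snd] at hs key ⊢
    linarith
  have hsum := Finset.sum_le_sum fun t (_ : t ∈ Finset.range N) => hone t
  rw [← Finset.mul_sum] at hsum
  have htel : ∑ t ∈ Finset.range N, (1 / 2 * ‖z t - u‖ ^ 2 - 1 / 2 * ‖z (t + 1) - u‖ ^ 2)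
      = 1 / 2 * ‖z 0 - u‖ ^ 2 - 1 / 2 * ‖z N - u‖ ^ 2 :=
    Finset.sum_range_sub' (fun t => 1 / 2 * ‖z t - u‖ ^ 2) N
  have h0 : ‖z 0 - u‖ ^ 2 ≤ D ^ 2 := pow_le_pow_left₀ (norm_nonneg _) (hD _ (hz 0) _ hu) 2
  -- Cauchy–Schwarz is applied after summation, which preserves the cancellation among the noise
  -- terms and is uniform in `u`.
  have hcs : ∑ t ∈ Finset.range N, (inner ℝ (noise M Φ ξ (x t) (z t)) (u - WithLp.toLp 2 z₀) : ℝ)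
      ≤ D * ‖∑ t ∈ Finset.range N, noise M Φ ξ (x t) (z t)‖ := by
    rw [← sum_inner, mul_comm]
    exact (real_inner_le_norm _ _).trans
      (mul_le_mul_of_nonneg_left (hD _ hu _ hz₀) (norm_nonneg _))
  rw [mul_inv, mul_comm a⁻¹, mul_assoc]
  refine mul_le_mul_of_nonneg_left ?_ (by positivity)
  rw [le_inv_mul_iff₀ ha]
  refine hsum.trans ?_
  rw [Finset.sum_add_distrib, Finset.sum_add_distrib, htel, ← Finset.mul_sum, ← Finset.mul_sum,
    ← Finset.mul_sum, Finset.sum_add_distrib, mul_add]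
  have := mul_le_mul_of_nonneg_left hcs ha.le
  nlinarith [sq_nonneg ‖z N - u‖]

end Pathwise

/-! ### Moments of the oracles under the sample law -/

section SampleLaw

theorem memLp_transition {S F : Type*} [Fintype S] [MeasurableSpace S]
    [MeasurableSingletonClass S] {ν : Measure (S × ℝ × S)} [IsFiniteMeasure ν]
    [NormedAddCommGroup F] (b : S → S → F) :
    MemLp (fun x : S × ℝ × S => b x.1 x.2.2) 2 ν := by
  obtain ⟨C, hC⟩ := (Set.finite_range fun p : S × S => ‖b p.1 p.2‖).bddAbove
  refine MemLp.of_bound ?_ C (Filter.Eventually.of_forall fun x => hC ⟨(x.1, x.2.2), rfl⟩)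
  exact ((StronglyMeasurable.of_discrete (f := fun p : S × S => b p.1 p.2)).comp_measurable
    (g := fun x : S × ℝ × S => (x.1, x.2.2)) (by fun_prop)).aestronglyMeasurable

/-- Separates the possibly unbounded reward, known through its conditional mean given s, from a
function of (s, s'), which takes finitely many values. -/
theorem oracleK_eq {S : Type*} {d : ℕ} (Φ : Matrix S (Fin d) ℝ) (γ : ℝ) (θ : Vec d) :
    (fun x => oracleK γ Φ x θ) = fun x =>
    x.2.1 • feat Φ x.1
      + (γ * inner ℝ (feat Φ x.2.2) θ - inner ℝ (feat Φ x.1) θ : ℝ) • feat Φ x.1 := by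
  funext x
  rw [oracleK, tdError]
  module

theorem inner_feat {S : Type*} {d : ℕ} (Φ : Matrix S (Fin d) ℝ) (s : S) (w : Vec d) :
    (inner ℝ (feat Φ s) w : ℝ) = (Φ *ᵥ w.ofLp) s := by
  rw [feat, EuclideanSpace.inner_eq_star_dotProduct]
  simp [Matrix.mulVec, dotProduct_comm]

variable {S : Type*} [Fintype S] [MeasurableSpace S] [MeasurableSingletonClass S] {d : ℕ}
  {M : MRP S} {ξ : S → ℝ} {ν : Measure (S × ℝ × S)}
  {E : Type*} [NormedAddCommGroup E] [NormedSpace ℝ E]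

theorem memLp_reward_smul [IsFiniteMeasure ν] (hν : IsSampleLaw M ξ ν) (A : S → E) :
    MemLp (fun x : S × ℝ × S => x.2.1 • A x.1) 2 ν := by
  obtain ⟨C, hC⟩ := (Set.finite_range fun s => ‖A s‖).bddAbove
  refine hν.reward_memLp.of_le_mul (c := C) ?_ (Filter.Eventually.of_forall fun x => ?_)
  · have h1 : StronglyMeasurable fun x : S × ℝ × S => A x.1 :=
      (StronglyMeasurable.of_discrete (f := A)).comp_measurable measurable_fst
    have h2 : StronglyMeasurable fun x : S × ℝ × S => x.2.1 :=
      (measurable_snd.fst).stronglyMeasurable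
    exact (h2.smul h1).aestronglyMeasurable
  · rw [norm_smul, mul_comm]
    exact mul_le_mul_of_nonneg_right (hC ⟨x.1, rfl⟩) (norm_nonneg _)

theorem integral_transition [CompleteSpace E] [IsFiniteMeasure ν] (hξ : IsPosDistribution ξ)
    (hν : IsSampleLaw M ξ ν) (b : S → S → E) :
    ∫ x, b x.1 x.2.2 ∂ν = ∑ s, ∑ s', (ξ s * M.P s s') • b s s' := by
  have hg : Measurable fun x : S × ℝ × S => (x.1, x.2.2) := by fun_prop
  have h1 : ∫ x, b x.1 x.2.2 ∂ν
      = ∫ p, b p.1 p.2 ∂(ν.map fun x : S × ℝ × S => (x.1, x.2.2)) :=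
    (integral_map (f := fun p : S × S => b p.1 p.2) hg.aemeasurable
      (StronglyMeasurable.of_discrete).aestronglyMeasurable).symm
  rw [h1, integral_fintype Integrable.of_finite, Fintype.sum_prod_type]
  refine Finset.sum_congr rfl fun s _ => Finset.sum_congr rfl fun s' _ => ?_
  congr 1
  rw [measureReal_def, Measure.map_apply hg (measurableSet_singleton _)]
  have h2 : (fun x : S × ℝ × S => (x.1, x.2.2)) ⁻¹' {(s, s')} = {x | x.1 = s ∧ x.2.2 = s'} := by
    ext x
    simp
  rw [h2, hν.transition, ENNReal.toReal_ofReal (mul_nonneg (hξ.pos s).le (M.P_nonneg s s'))]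

theorem integral_reward_smul [CompleteSpace E] [IsFiniteMeasure ν] (hν : IsSampleLaw M ξ ν)
    (A : S → E) : ∫ x, x.2.1 • A x.1 ∂ν = ∑ s, (ξ s * M.R s) • A s := by
  classical
  have hm : ∀ s, MeasurableSet {x : S × ℝ × S | x.1 = s} := fun s =>
    measurable_fst (measurableSet_singleton s)
  have h1 : (fun x : S × ℝ × S => x.2.1 • A x.1)
      = fun x => ∑ s, ({x : S × ℝ × S | x.1 = s}.indicator (fun x => x.2.1) x) • A s := by
    funext x
    rw [Finset.sum_eq_single x.1]
    · rw [Set.indicator_of_mem (by simp)]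
    · intro s _ hs
      rw [Set.indicator_of_notMem (by simpa using hs.symm), zero_smul]
    · simp
  have hint : Integrable (fun x : S × ℝ × S => x.2.1) ν :=
    hν.reward_memLp.integrable (by norm_num)
  rw [h1, integral_finsetSum _ fun s _ => (hint.indicator (hm s)).smul_const _]
  refine Finset.sum_congr rfl fun s _ => ?_
  rw [integral_smul_const, integral_indicator (hm s), hν.reward_mean]

variable (Φ : Matrix S (Fin d) ℝ)

theorem memLp_oracleF [IsFiniteMeasure ν] (w : Vec d) : MemLp (fun x => oracleF Φ x w) 2 ν :=
  memLp_transition fun s _ => (inner ℝ (feat Φ s) w : ℝ) • feat Φ s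

theorem memLp_oracleKT [IsFiniteMeasure ν] (γ : ℝ) (w : Vec d) :
    MemLp (fun x => oracleKT γ Φ x w) 2 ν :=
  memLp_transition fun s s' => -((inner ℝ (feat Φ s) w : ℝ) • (feat Φ s - γ • feat Φ s'))

theorem memLp_oracleK [IsFiniteMeasure ν] (hν : IsSampleLaw M ξ ν) (γ : ℝ) (θ : Vec d) :
    MemLp (fun x => oracleK γ Φ x θ) 2 ν := by
  rw [oracleK_eq]
  exact (memLp_reward_smul hν (feat Φ)).add (memLp_transition fun s s' =>
    (γ * inner ℝ (feat Φ s') θ - inner ℝ (feat Φ s) θ : ℝ) • feat Φ s)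

variable [DecidableEq S]

theorem integral_oracleF [IsFiniteMeasure ν] (hξ : IsPosDistribution ξ) (hν : IsSampleLaw M ξ ν)
    (w : Vec d) :
    ∫ x, oracleF Φ x w ∂ν = Matrix.toEuclideanCLM (𝕜 := ℝ) (gram Φ ξ) w := by
  have h := integral_transition hξ hν fun s _ => (inner ℝ (feat Φ s) w : ℝ) • feat Φ s
  unfold oracleF
  rw [h]
  ext i
  rw [Matrix.ofLp_toEuclideanCLM, gram, ← Matrix.mulVec_mulVec, ← Matrix.mulVec_mulVec,
    Matrix.mulVec, dotProduct]
  simp only [← Finset.sum_smul, ← Finset.mul_sum, M.P_sum, WithLp.ofLp_sum, Finset.sum_apply,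
    PiLp.smul_apply, smul_eq_mul, mul_one, Matrix.mulVec_diagonal, inner_feat,
    Matrix.transpose_apply]
  refine Finset.sum_congr rfl fun s _ => ?_
  simp only [feat]
  ring

theorem integral_oracleKT [IsFiniteMeasure ν] (hξ : IsPosDistribution ξ)
    (hν : IsSampleLaw M ξ ν) (w : Vec d) : ∫ x, oracleKT M.γ Φ x w ∂ν
      = -Matrix.toEuclideanCLM (𝕜 := ℝ) (coupling M Φ ξ)ᵀ w := by
  have h := integral_transition hξ hν fun s s' =>
    -((inner ℝ (feat Φ s) w : ℝ) • (feat Φ s - M.γ • feat Φ s'))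
  unfold oracleKT
  rw [h]
  ext i
  rw [PiLp.neg_apply, Matrix.ofLp_toEuclideanCLM, coupling, Matrix.transpose_mul,
    Matrix.transpose_mul, Matrix.transpose_transpose, Matrix.diagonal_transpose,
    ← Matrix.mulVec_mulVec, ← Matrix.mulVec_mulVec, Matrix.mulVec, dotProduct,
    ← Finset.sum_neg_distrib]
  simp only [WithLp.ofLp_sum, Finset.sum_apply]
  refine Finset.sum_congr rfl fun s _ => ?_
  simp only [Matrix.transpose_apply, Matrix.mulVec_diagonal, Matrix.sub_apply, Matrix.smul_apply,
    Matrix.mul_apply, PiLp.smul_apply, PiLp.neg_apply, PiLp.sub_apply, smul_eq_mul, feat]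
  have h1 : Φ s i = ∑ s', M.P s s' * Φ s i := by rw [← Finset.sum_mul, M.P_sum, one_mul]
  conv_rhs => rw [h1]
  rw [Finset.mul_sum, ← Finset.sum_sub_distrib, Finset.sum_mul, ← Finset.sum_neg_distrib]
  refine Finset.sum_congr rfl fun s' _ => ?_
  have h2 := inner_feat Φ s w
  rw [feat] at h2
  rw [h2]
  ring

theorem integral_oracleK [IsFiniteMeasure ν] (hξ : IsPosDistribution ξ)
    (hν : IsSampleLaw M ξ ν) (θ : Vec d) : ∫ x, oracleK M.γ Φ x θ ∂ν = K M Φ ξ θ := by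
  have h1 := integral_transition hξ hν fun s s' =>
    (M.γ * inner ℝ (feat Φ s') θ - inner ℝ (feat Φ s) θ : ℝ) • feat Φ s
  have h2 := integral_reward_smul hν (feat Φ)
  rw [oracleK_eq, integral_add ((memLp_reward_smul hν (feat Φ)).integrable (by norm_num))
    ((memLp_transition fun s s' =>
      (M.γ * inner ℝ (feat Φ s') θ - inner ℝ (feat Φ s) θ : ℝ) • feat Φ s).integrable
        (by norm_num)), h1, h2, ← Finset.sum_add_distrib]
  set v : S → ℝ := Φ *ᵥ θ.ofLp with hv
  ext i
  have hK : (K M Φ ξ θ).ofLp i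
      = ∑ s, Φ s i * (ξ s * (M.R s + M.γ * (M.P *ᵥ v) s - v s)) := by
    simp only [K, bellman, value, ← hv]
    rw [Matrix.mulVec, dotProduct]
    refine Finset.sum_congr rfl fun s _ => ?_
    rw [Matrix.mulVec_diagonal]
    rfl
  rw [hK, WithLp.ofLp_sum, Finset.sum_apply]
  refine Finset.sum_congr rfl fun s _ => ?_
  have h3 : ∑ s', ξ s * M.P s s' * (M.γ * v s' - v s)
      = ξ s * (M.γ * (M.P *ᵥ v) s - v s) := by
    have h4 : v s = ∑ s', M.P s s' * v s := by rw [← Finset.sum_mul, M.P_sum, one_mul]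
    conv_rhs => rw [h4]
    rw [Matrix.mulVec, dotProduct, Finset.mul_sum, ← Finset.sum_sub_distrib, Finset.mul_sum]
    exact Finset.sum_congr rfl fun s' _ => by ring
  simp only [inner_feat, ← hv, smul_smul, ← Finset.sum_smul]
  rw [h3, ← add_smul, PiLp.smul_apply, smul_eq_mul]
  simp only [feat]
  ring

theorem memLp_noise [IsFiniteMeasure ν] (hν : IsSampleLaw M ξ ν) (z : Pair d) :
    MemLp (fun x => noise M Φ ξ x z) 2 ν := by
  rw [memLp_prodLp_iff]
  exact ⟨(memLp_oracleKT Φ M.γ z.snd).sub (memLp_const _),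
    ((memLp_oracleF Φ z.snd).sub (memLp_oracleK Φ hν M.γ z.fst)).sub (memLp_const _)⟩

theorem integral_noise [IsProbabilityMeasure ν] (hξ : IsPosDistribution ξ)
    (hν : IsSampleLaw M ξ ν) (z : Pair d) : ∫ x, noise M Φ ξ x z ∂ν = 0 := by
  have h1 : Integrable (fun x => oracleKT M.γ Φ x z.snd) ν :=
    (memLp_oracleKT Φ M.γ z.snd).integrable (by norm_num)
  have h2 : Integrable (fun x => oracleF Φ x z.snd) ν :=
    (memLp_oracleF Φ z.snd).integrable (by norm_num)
  have h3 : Integrable (fun x => oracleK M.γ Φ x z.fst) ν :=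
    (memLp_oracleK Φ hν M.γ z.fst).integrable (by norm_num)
  have hi : Integrable (fun x => noise M Φ ξ x z) ν :=
    (memLp_noise Φ hν z).integrable (by norm_num)
  have e1 : (∫ x, noise M Φ ξ x z ∂ν).fst = 0 := by
    have h := (WithLp.fstL 2 ℝ (Vec d) (Vec d)).integral_comp_comm hi
    change _ = (∫ x, noise M Φ ξ x z ∂ν).fst at h
    rw [← h]
    change ∫ x, (oracleKT M.γ Φ x z.snd
      - (-Matrix.toEuclideanCLM (𝕜 := ℝ) (coupling M Φ ξ)ᵀ z.snd)) ∂ν = 0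
    rw [integral_sub h1 (integrable_const _), integral_oracleKT Φ hξ hν]
    simp
  have e2 : (∫ x, noise M Φ ξ x z ∂ν).snd = 0 := by
    have h := (WithLp.sndL 2 ℝ (Vec d) (Vec d)).integral_comp_comm hi
    change _ = (∫ x, noise M Φ ξ x z ∂ν).snd at h
    rw [← h]
    change ∫ x, (oracleF Φ x z.snd - oracleK M.γ Φ x z.fst
      - (Matrix.toEuclideanCLM (𝕜 := ℝ) (gram Φ ξ) z.snd - K M Φ ξ z.fst)) ∂ν = 0
    have h23 : Integrable (fun x => oracleF Φ x z.snd - oracleK M.γ Φ x z.fst) ν := h2.sub h3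
    rw [integral_sub h23 (integrable_const _), integral_sub h2 h3,
      integral_oracleF Φ hξ hν, integral_oracleK Φ hξ hν]
    simp
  apply WithLp.ofLp_injective
  exact Prod.ext e1 e2

/-- The oracles for `F*` and `K` share a sample and may be correlated, so their difference costs a
factor 2: the bound is σKy² + 2(σF² + σKθ²) ≤ 2σ². -/
theorem integral_norm_noise_sq_le [IsProbabilityMeasure ν] (hν : IsSampleLaw M ξ ν)
    {X Y : Set (Vec d)} {σF σKθ σKy : ℝ} (hσ : 0 ≤ σKy)
    (hvar : OracleVarianceBound M Φ ξ ν X Y σF σKθ σKy) {z : Pair d} (hz : z ∈ feasible X Y) :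
    ∫ x, ‖noise M Φ ξ x z‖ ^ 2 ∂ν ≤ 2 * (Real.sqrt (σF ^ 2 + σKθ ^ 2) + σKy) ^ 2 := by
  have i1 := ((memLp_oracleKT (ν := ν) Φ M.γ z.snd).sub
    (memLp_const (-Matrix.toEuclideanCLM (𝕜 := ℝ) (coupling M Φ ξ)ᵀ z.snd))).integrable_norm_pow'
  have i2 := ((memLp_oracleF (ν := ν) Φ z.snd).sub
    (memLp_const (Matrix.toEuclideanCLM (𝕜 := ℝ) (gram Φ ξ) z.snd))).integrable_norm_pow'
  have i3 := ((memLp_oracleK Φ hν M.γ z.fst).sub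
    (memLp_const (K M Φ ξ z.fst))).integrable_norm_pow'
  simp only [Pi.sub_apply] at i1 i2 i3
  have hle : ∀ x, ‖noise M Φ ξ x z‖ ^ 2 ≤
      ‖oracleKT M.γ Φ x z.snd - (-Matrix.toEuclideanCLM (𝕜 := ℝ) (coupling M Φ ξ)ᵀ z.snd)‖ ^ 2
      + (2 * ‖oracleF Φ x z.snd - Matrix.toEuclideanCLM (𝕜 := ℝ) (gram Φ ξ) z.snd‖ ^ 2
        + 2 * ‖oracleK M.γ Φ x z.fst - K M Φ ξ z.fst‖ ^ 2) := by
    intro x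
    have e : (noise M Φ ξ x z).snd
        = (oracleF Φ x z.snd - Matrix.toEuclideanCLM (𝕜 := ℝ) (gram Φ ξ) z.snd)
          - (oracleK M.γ Φ x z.fst - K M Φ ξ z.fst) := by
      change oracleF Φ x z.snd - oracleK M.γ Φ x z.fst
        - (Matrix.toEuclideanCLM (𝕜 := ℝ) (gram Φ ξ) z.snd - K M Φ ξ z.fst) = _
      abel
    rw [WithLp.prod_norm_sq_eq_of_L2, e]
    refine add_le_add le_rfl ?_
    have n := pow_le_pow_left₀ (norm_nonneg _) (norm_sub_le
      (oracleF Φ x z.snd - Matrix.toEuclideanCLM (𝕜 := ℝ) (gram Φ ξ) z.snd)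
      (oracleK M.γ Φ x z.fst - K M Φ ξ z.fst)) 2
    nlinarith [sq_nonneg (‖oracleF Φ x z.snd - Matrix.toEuclideanCLM (𝕜 := ℝ) (gram Φ ξ) z.snd‖
      - ‖oracleK M.γ Φ x z.fst - K M Φ ξ z.fst‖)]
  have hmono := integral_mono_of_nonneg (μ := ν)
    (Filter.Eventually.of_forall fun x => sq_nonneg ‖noise M Φ ξ x z‖)
    (i1.add ((i2.const_mul 2).add (i3.const_mul 2))) (Filter.Eventually.of_forall hle)
  rw [integral_add' i1 ((i2.const_mul 2).add (i3.const_mul 2)),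
    integral_add' (i2.const_mul 2) (i3.const_mul 2), integral_const_mul,
    integral_const_mul] at hmono
  have v1 := hvar.varKT z.snd hz.2
  have v2 := hvar.varF z.snd hz.2
  have v3 := hvar.varK z.fst hz.1
  have hs := Real.sq_sqrt (add_nonneg (sq_nonneg σF) (sq_nonneg σKθ))
  nlinarith [mul_nonneg (Real.sqrt_nonneg (σF ^ 2 + σKθ ^ 2)) hσ]

theorem measurable_noise :
    Measurable fun q : (S × ℝ × S) × Pair d => noise M Φ ξ q.1 q.2 := by
  have m1 : Measurable fun q : (S × ℝ × S) × Pair d => feat Φ q.1.1 :=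
    (Measurable.of_discrete (f := feat Φ)).comp (by fun_prop)
  have m2 : Measurable fun q : (S × ℝ × S) × Pair d => feat Φ q.1.2.2 :=
    (Measurable.of_discrete (f := feat Φ)).comp (by fun_prop)
  have c1 : Continuous fun z : Pair d => z.fst := by fun_prop
  have c2 : Continuous fun z : Pair d => z.snd := by fun_prop
  have z1 : Measurable fun q : (S × ℝ × S) × Pair d => q.2.fst := c1.measurable.comp measurable_snd
  have z2 : Measurable fun q : (S × ℝ × S) × Pair d => q.2.snd := c2.measurable.comp measurable_snd
  have mr : Measurable fun q : (S × ℝ × S) × Pair d => q.1.2.1 := by fun_prop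
  have hF : Continuous (field M Φ ξ) := by
    have := continuous_K M Φ (ξ := ξ)
    unfold field
    fun_prop
  refine Measurable.sub ?_ (hF.measurable.comp measurable_snd)
  refine (WithLp.prod_continuous_toLp 2 (Vec d) (Vec d)).measurable.comp (Measurable.prodMk ?_ ?_)
  · exact ((Measurable.inner (𝕜 := ℝ) m1 z2).smul (m1.sub (m2.const_smul M.γ))).neg
  · unfold oracleF oracleK tdError
    exact ((Measurable.inner (𝕜 := ℝ) m1 z2).smul m1).sub
      (Measurable.smul ((mr.add ((Measurable.inner (𝕜 := ℝ) m2 z1).const_mul M.γ)).sub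
        (Measurable.inner (𝕜 := ℝ) m1 z1)) m1)

end SampleLaw

/-! ### Independence of a sample from the past -/

section Independence

variable {Ω α β : Type*} {mΩ : MeasurableSpace Ω} [mα : MeasurableSpace α]
  [mβ : MeasurableSpace β] {μ : Measure Ω}

/-- A function of an independent pair that has mean zero for each fixed first argument has mean
zero. -/
theorem integral_eq_zero_of_indepFun [IsProbabilityMeasure μ] {U : Ω → β} {X : Ω → α}
    (hU : Measurable U) (hX : Measurable X) (hind : IndepFun U X μ) {g : β × α → ℝ} (hg : Measurable g)
    (hint : Integrable (fun ω => g (U ω, X ω)) μ) (h0 : ∀ u, ∫ x, g (u, x) ∂(μ.map X) = 0) :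
    ∫ ω, g (U ω, X ω) ∂μ = 0 := by
  have hUX : Measurable fun ω => (U ω, X ω) := hU.prodMk hX
  have hmap := (indepFun_iff_map_prod_eq_prod_map_map hU.aemeasurable hX.aemeasurable).1 hind
  have : IsProbabilityMeasure (μ.map U) := Measure.isProbabilityMeasure_map hU.aemeasurable
  have : IsProbabilityMeasure (μ.map X) := Measure.isProbabilityMeasure_map hX.aemeasurable
  have h1 : ∫ ω, g (U ω, X ω) ∂μ = ∫ p, g p ∂((μ.map U).prod (μ.map X)) := by
    rw [← hmap, integral_map hUX.aemeasurable hg.aestronglyMeasurable]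
  have h2 : Integrable g ((μ.map U).prod (μ.map X)) := by
    rw [← hmap, integrable_map_measure hg.aestronglyMeasurable hUX.aemeasurable]
    exact hint
  rw [h1, integral_prod _ h2]
  simp only [h0, integral_zero]

/-- The σ-algebra generated by the samples before time `t`. -/
abbrev past (x : ℕ → Ω → α) (t : ℕ) : MeasurableSpace Ω :=
  ⨆ i ∈ Set.Iio t, mα.comap (x i)

theorem past_le {x : ℕ → Ω → α} (hx : ∀ t, Measurable (x t)) (t : ℕ) : past x t ≤ mΩ :=
  iSup₂_le fun i _ => (hx i).comap_le

theorem past_mono (x : ℕ → Ω → α) (t : ℕ) : past x t ≤ past x (t + 1) :=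
  biSup_mono fun _ hi => lt_trans hi (Nat.lt_succ_self t)

theorem measurable_past (x : ℕ → Ω → α) (t : ℕ) : Measurable[past x (t + 1)] (x t) :=
  (comap_measurable (x t)).mono
    (le_biSup (fun i => mα.comap (x i)) (Set.mem_Iio.2 (Nat.lt_succ_self t))) le_rfl

theorem indepFun_of_measurable_past {x : ℕ → Ω → α} (hx : ∀ t, Measurable (x t))
    (hind : iIndepFun x μ) {t : ℕ} {U : Ω → β} (hU : Measurable[past x t] U) :
    IndepFun U (x t) μ := by
  have h1 := indep_iSup_of_disjoint (fun i => (hx i).comap_le) hind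
    (S := Set.Iio t) (T := {t}) (by simp)
  rw [IndepFun_iff_Indep]
  refine indep_of_indep_of_le_right (indep_of_indep_of_le_left h1 hU.comap_le) ?_
  exact le_biSup (fun i => mα.comap (x i)) (Set.mem_singleton t)

theorem integrable_comp_sample {x : ℕ → Ω → α} {ν : Measure α} {Q : α → ℝ}
    (hx : ∀ t, Measurable (x t)) (hlaw : ∀ t, μ.map (x t) = ν)
    (hQi : Integrable Q ν) (t : ℕ) : Integrable (fun ω => Q (x t ω)) μ := by
  rw [← hlaw t] at hQi
  exact hQi.comp_measurable (hx t)

theorem integral_comp_sample {x : ℕ → Ω → α} {ν : Measure α} {Q : α → ℝ}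
    (hx : ∀ t, Measurable (x t)) (hlaw : ∀ t, μ.map (x t) = ν)
    (hQi : Integrable Q ν) (t : ℕ) : ∫ ω, Q (x t ω) ∂μ = ∫ y, Q y ∂ν := by
  rw [← hlaw t] at hQi ⊢
  exact (integral_map (hx t).aemeasurable hQi.aestronglyMeasurable).symm

theorem integrable_inner_of_memLp {V : Type*} [NormedAddCommGroup V] [InnerProductSpace ℝ V]
    {f g : Ω → V} (hf : MemLp f 2 μ) (hg : MemLp g 2 μ) :
    Integrable (fun ω => (inner ℝ (f ω) (g ω) : ℝ)) μ := by
  refine ((hf.norm.integrable_mul hg.norm)).mono' (hf.1.inner hg.1)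
    (Filter.Eventually.of_forall fun ω => ?_)
  exact norm_inner_le_norm _ _

/-- The variance of ‖f‖ is nonnegative. -/
theorem integral_norm_le_sqrt [IsProbabilityMeasure μ] {V : Type*} [NormedAddCommGroup V]
    {f : Ω → V} (hf : MemLp f 2 μ) :
    ∫ ω, ‖f ω‖ ∂μ ≤ Real.sqrt (∫ ω, ‖f ω‖ ^ 2 ∂μ) := by
  have h1 := variance_nonneg (fun ω => ‖f ω‖) μ
  rw [variance_eq_sub hf.norm] at h1
  refine Real.le_sqrt_of_sq_le ?_
  simp only [Pi.pow_apply] at h1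
  linarith

end Independence

/-! ### The noise along the iterates as a martingale difference sequence -/

section Noise

variable {S : Type*} [Fintype S] [MeasurableSpace S] [MeasurableSingletonClass S]
  {d : ℕ} {X Y : Set (Vec d)} {h : Vec d → ℝ} {M : MRP S} {Φ : Matrix S (Fin d) ℝ} {ξ : S → ℝ}
  {ν : Measure (S × ℝ × S)} {a : ℝ} {Ω : Type*} {mΩ : MeasurableSpace Ω} {μ : Measure Ω}
  {x : ℕ → Ω → S × ℝ × S} {z₀ : Vec d × Vec d}

theorem Admissible.measurable_step_comp (H : Admissible X Y h) (ha : 0 ≤ a) (γ : ℝ)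
    {m : MeasurableSpace Ω} {f : Ω → S × ℝ × S} {z g : Ω → Pair d} (hf : Measurable[m] f)
    (hz : Measurable[m] z) (hg : Measurable[m] g) :
    Measurable[m] fun ω => step X Y h γ Φ a (f ω) (z ω) (g ω) :=
  ((H.measurable_step (γ := γ) (Φ := Φ) ha).comp (hf.prodMk (hz.prodMk hg)) :)

/-- Adaptedness: z_t uses the samples before time t only. The extragradient point z_{t+1/2} already
uses sample t, so the analogue for `halfPath` is not available. -/
theorem measurable_past_path (H : Admissible X Y h) (ha : 0 ≤ a) (γ : ℝ) (t : ℕ) :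
    Measurable[past x t] fun ω => path X Y h γ Φ a (fun t => x t ω) z₀ t := by
  induction t with
  | zero => exact @measurable_const _ _ _ (past x 0) (WithLp.toLp 2 z₀)
  | succ t ih =>
    have h1 := Measurable.le (past_mono x t) ih
    have h2 := measurable_past x t
    simp only [path_succ, halfPath_eq]
    exact H.measurable_step_comp ha γ h2 h1 (H.measurable_step_comp ha γ h2 h1 h1)

theorem measurable_path (H : Admissible X Y h) (ha : 0 ≤ a) (γ : ℝ)
    (hx : ∀ t, Measurable (x t)) (t : ℕ) :
    Measurable fun ω => path X Y h γ Φ a (fun t => x t ω) z₀ t :=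
  Measurable.le (past_le hx t) (measurable_past_path H ha γ t)

theorem measurable_average (H : Admissible X Y h) (ha : 0 ≤ a) (γ : ℝ)
    (hx : ∀ t, Measurable (x t)) (N : ℕ) :
    Measurable fun ω => average X Y h γ Φ (fun _ => a) (fun _ => a) (fun t => x t ω) z₀ N := by
  have h1 : ∀ t, Measurable fun ω => halfPath X Y h γ Φ a (fun t => x t ω) z₀ t := fun t => by
    have h2 := measurable_path (Φ := Φ) (z₀ := z₀) H ha γ hx t
    simp only [halfPath_eq]
    exact H.measurable_step_comp ha γ (hx t) h2 h2
  have h2 : ∀ t, Measurable fun ω =>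
      halfIter X Y h γ Φ (fun _ => a) (fun _ => a) (fun t => x t ω) z₀ t := fun t =>
    (WithLp.prod_continuous_ofLp 2 (Vec d) (Vec d)).measurable.comp (h1 t)
  unfold average
  exact (Finset.measurable_fun_sum _ fun t _ => h2 t).const_smul (N : ℝ)⁻¹

variable [DecidableEq S]

theorem measurable_noise_comp (M : MRP S) (Φ : Matrix S (Fin d) ℝ) (ξ : S → ℝ)
    {m : MeasurableSpace Ω} {f : Ω → S × ℝ × S} {z : Ω → Pair d} (hf : Measurable[m] f)
    (hz : Measurable[m] z) : Measurable[m] fun ω => noise M Φ ξ (f ω) (z ω) :=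
  ((measurable_noise (M := M) (ξ := ξ) Φ).comp (hf.prodMk hz) :)

theorem measurable_noise_path (H : Admissible X Y h) (ha : 0 ≤ a) (hx : ∀ t, Measurable (x t))
    (t : ℕ) : Measurable fun ω =>
      noise M Φ ξ (x t ω) (path X Y h M.γ Φ a (fun t => x t ω) z₀ t) :=
  measurable_noise_comp M Φ ξ (hx t) (measurable_path H ha M.γ hx t)

theorem measurable_past_sum_noise (H : Admissible X Y h) (ha : 0 ≤ a) (N : ℕ) :
    Measurable[past x N] fun ω => ∑ t ∈ Finset.range N,
      noise M Φ ξ (x t ω) (path X Y h M.γ Φ a (fun t => x t ω) z₀ t) := by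
  induction N with
  | zero => exact @measurable_const _ _ _ (past x 0) 0
  | succ N ih =>
    simp only [Finset.sum_range_succ]
    exact (Measurable.le (past_mono x N) ih).add (measurable_noise_comp M Φ ξ (measurable_past x N)
      (Measurable.le (past_mono x N) (measurable_past_path H ha M.γ N)))

/-- The noise at time `t` is orthogonal to the past. -/
theorem integral_inner_noise_eq_zero [IsProbabilityMeasure ν] [IsProbabilityMeasure μ]
    (hξ : IsPosDistribution ξ) (hν : IsSampleLaw M ξ ν)
    (H : Admissible X Y h) (ha : 0 ≤ a) (hx : ∀ t, Measurable (x t)) (hind : iIndepFun x μ)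
    (hlaw : ∀ t, μ.map (x t) = ν) (t : ℕ) {W : Ω → Pair d} (hW : Measurable[past x t] W)
    (hint : Integrable (fun ω => (inner ℝ
      (noise M Φ ξ (x t ω) (path X Y h M.γ Φ a (fun t => x t ω) z₀ t)) (W ω) : ℝ)) μ) :
    ∫ ω, (inner ℝ (noise M Φ ξ (x t ω) (path X Y h M.γ Φ a (fun t => x t ω) z₀ t)) (W ω) : ℝ) ∂μ
      = 0 := by
  have hU : Measurable[past x t] fun ω => (path X Y h M.γ Φ a (fun t => x t ω) z₀ t, W ω) :=
    (measurable_past_path H ha M.γ t).prodMk hW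
  refine integral_eq_zero_of_indepFun
    (U := fun ω => (path X Y h M.γ Φ a (fun t => x t ω) z₀ t, W ω))
    (g := fun p : (Pair d × Pair d) × S × ℝ × S => inner ℝ (noise M Φ ξ p.2 p.1.1) p.1.2)
    (Measurable.le (past_le hx t) hU) (hx t) (indepFun_of_measurable_past hx hind hU) ?_ hint ?_
  · exact Measurable.inner (𝕜 := ℝ) (measurable_noise_comp M Φ ξ measurable_snd
      measurable_fst.fst) measurable_fst.snd
  · rintro ⟨z, w⟩
    rw [hlaw]
    simp only [real_inner_comm]
    rw [integral_inner ((memLp_noise Φ hν z).integrable (by norm_num)), integral_noise Φ hξ hν,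
      inner_zero_right]

variable {Q : S × ℝ × S → ℝ}

theorem memLp_noise_path (H : Admissible X Y h) (ha : 0 ≤ a) (hx : ∀ t, Measurable (x t))
    (hlaw : ∀ t, μ.map (x t) = ν) (hz₀ : WithLp.toLp 2 z₀ ∈ feasible X Y)
    (hQi : Integrable Q ν) (hQ : ∀ y, ∀ z ∈ feasible X Y, ‖noise M Φ ξ y z‖ ^ 2 ≤ Q y) (t : ℕ) :
    MemLp (fun ω => noise M Φ ξ (x t ω) (path X Y h M.γ Φ a (fun t => x t ω) z₀ t)) 2 μ := by
  have hm := (measurable_noise_path (M := M) (Φ := Φ) (ξ := ξ) (z₀ := z₀) H ha hx t)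
  rw [memLp_two_iff_integrable_sq_norm hm.aestronglyMeasurable]
  refine (integrable_comp_sample hx hlaw hQi t).mono'
    (hm.norm.pow_const 2).aestronglyMeasurable (Filter.Eventually.of_forall fun ω => ?_)
  rw [Real.norm_of_nonneg (sq_nonneg _)]
  exact hQ _ _ (H.path_mem _ hz₀ t)

/-- Each new noise term is orthogonal in L² to the sum of the earlier ones, so second moments add:
the sum has size √N rather than N. -/
theorem integral_norm_sum_noise_sq_le [IsProbabilityMeasure ν] [IsProbabilityMeasure μ]
    (hξ : IsPosDistribution ξ) (hν : IsSampleLaw M ξ ν)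
    (H : Admissible X Y h) (ha : 0 ≤ a) (hx : ∀ t, Measurable (x t)) (hind : iIndepFun x μ)
    (hlaw : ∀ t, μ.map (x t) = ν) (hz₀ : WithLp.toLp 2 z₀ ∈ feasible X Y)
    (hQi : Integrable Q ν) (hQ : ∀ y, ∀ z ∈ feasible X Y, ‖noise M Φ ξ y z‖ ^ 2 ≤ Q y) (N : ℕ) :
    MemLp (fun ω => ∑ t ∈ Finset.range N,
      noise M Φ ξ (x t ω) (path X Y h M.γ Φ a (fun t => x t ω) z₀ t)) 2 μ ∧
    ∫ ω, ‖∑ t ∈ Finset.range N,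
      noise M Φ ξ (x t ω) (path X Y h M.γ Φ a (fun t => x t ω) z₀ t)‖ ^ 2 ∂μ
        ≤ N * ∫ y, Q y ∂ν := by
  induction N with
  | zero => simp
  | succ N ih =>
    obtain ⟨hmem, hle⟩ := ih
    set Z : Ω → Pair d := fun ω => ∑ t ∈ Finset.range N,
      noise M Φ ξ (x t ω) (path X Y h M.γ Φ a (fun t => x t ω) z₀ t) with hZ
    set n : Ω → Pair d := fun ω =>
      noise M Φ ξ (x N ω) (path X Y h M.γ Φ a (fun t => x t ω) z₀ N) with hn
    have hnm : MemLp n 2 μ := memLp_noise_path H ha hx hlaw hz₀ hQi hQ N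
    have hsum : (fun ω => ∑ t ∈ Finset.range (N + 1),
        noise M Φ ξ (x t ω) (path X Y h M.γ Φ a (fun t => x t ω) z₀ t)) = fun ω => Z ω + n ω := by
      funext ω
      rw [Finset.sum_range_succ]
    have hcross : ∫ ω, (inner ℝ (n ω) (Z ω) : ℝ) ∂μ = 0 :=
      integral_inner_noise_eq_zero hξ hν H ha hx hind hlaw N
        (measurable_past_sum_noise H ha N) (integrable_inner_of_memLp hnm hmem)
    have hn2 : ∫ ω, ‖n ω‖ ^ 2 ∂μ ≤ ∫ y, Q y ∂ν := by
      rw [← integral_comp_sample hx hlaw hQi N]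
      exact integral_mono_of_nonneg (Filter.Eventually.of_forall fun ω => sq_nonneg _)
        (integrable_comp_sample hx hlaw hQi N)
        (Filter.Eventually.of_forall fun ω => hQ _ _ (H.path_mem _ hz₀ N))
    refine ⟨by rw [hsum]; exact hmem.add hnm, ?_⟩
    have e : ∀ ω, ‖Z ω + n ω‖ ^ 2 = ‖Z ω‖ ^ 2 + (2 * inner ℝ (n ω) (Z ω) + ‖n ω‖ ^ 2) := by
      intro ω
      rw [norm_add_sq_real, real_inner_comm]
      ring
    have i1 : Integrable (fun ω => ‖Z ω‖ ^ 2) μ :=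
      (memLp_two_iff_integrable_sq_norm hmem.1).1 hmem
    have i2 : Integrable (fun ω => 2 * (inner ℝ (n ω) (Z ω) : ℝ)) μ :=
      (integrable_inner_of_memLp hnm hmem).const_mul 2
    have i3 : Integrable (fun ω => ‖n ω‖ ^ 2) μ := (memLp_two_iff_integrable_sq_norm hnm.1).1 hnm
    have i23 : Integrable (fun ω => 2 * (inner ℝ (n ω) (Z ω) : ℝ) + ‖n ω‖ ^ 2) μ := i2.add i3
    calc _ = ∫ ω, (‖Z ω‖ ^ 2 + (2 * inner ℝ (n ω) (Z ω) + ‖n ω‖ ^ 2)) ∂μ := by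
          refine integral_congr_ae (Filter.Eventually.of_forall fun ω => ?_)
          simp only
          rw [← e, Finset.sum_range_succ]
      _ = ∫ ω, ‖Z ω‖ ^ 2 ∂μ + (2 * ∫ ω, (inner ℝ (n ω) (Z ω) : ℝ) ∂μ + ∫ ω, ‖n ω‖ ^ 2 ∂μ) := by
          rw [integral_add i1 i23, integral_add i2 i3, integral_const_mul]
      _ ≤ _ := by
          rw [hcross]
          push_cast
          linarith

end Noise

/-! ### Integrability of the gap, and the gap as a bound for the primal objective -/

section Gap

variable {d : ℕ} {X Y : Set (Vec d)} {h : Vec d → ℝ}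

/-- Nothing is known of `f` outside `C` (as for `h` outside `X`), so measurability is obtained by
factoring through the subtype. -/
theorem integrable_comp_of_continuousOn {Ω E : Type*} {mΩ : MeasurableSpace Ω} {μ : Measure Ω}
    [IsFiniteMeasure μ] [TopologicalSpace E] [MeasurableSpace E] [BorelSpace E] {C : Set E}
    (hC : IsCompact C) {f : E → ℝ} (hf : ContinuousOn f C) {Z : Ω → E} (hZ : Measurable Z)
    (hmem : ∀ ω, Z ω ∈ C) : Integrable (fun ω => f (Z ω)) μ := by
  obtain ⟨B, hB⟩ := hC.exists_bound_of_continuousOn hf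
  have hm : Measurable fun ω => f (Z ω) :=
    (continuousOn_iff_continuous_domRestrict.1 hf).measurable.comp (hZ.subtype_mk (h := hmem))
  exact Integrable.of_bound hm.aestronglyMeasurable B
    (Filter.Eventually.of_forall fun ω => hB _ (hmem ω))

variable {S : Type*} [Fintype S] [DecidableEq S] (M : MRP S) (Φ : Matrix S (Fin d) ℝ)
  (ξ : S → ℝ)

/-- Extrema of a jointly continuous function over a compact set depend continuously on the
parameter. `X` is treated as a space of its own because `h` is continuous only there. -/
theorem continuousOn_dualityGap (H : Admissible X Y h) :
    ContinuousOn (dualityGap M Φ ξ h X Y) (X ×ˢ Y) := by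
  have cK := continuous_K M Φ (ξ := ξ)
  have cF := continuous_Fstar Φ (ξ := ξ)
  have ch : Continuous fun θ : X => h θ := continuousOn_iff_continuous_domRestrict.1 H.continuousOn
  have h1 : Continuous fun θ : X => sSup ((fun w => saddle M Φ ξ h θ w) '' Y) := by
    refine IsCompact.continuous_sSup (f := fun (θ : X) w => saddle M Φ ξ h θ w) H.compactY ?_
    exact (((cK.comp (continuous_subtype_val.comp continuous_fst)).inner continuous_snd).sub
      (cF.comp continuous_snd)).add (ch.comp continuous_fst)
  have : CompactSpace X := isCompact_iff_compactSpace.1 H.compactX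
  have h2 : Continuous fun w => sInf ((fun θ => saddle M Φ ξ h θ w) '' X) := by
    have h3 : Continuous fun w => sInf ((fun θ : X => saddle M Φ ξ h θ w) '' Set.univ) := by
      refine IsCompact.continuous_sInf (f := fun w (θ : X) => saddle M Φ ξ h θ w)
        isCompact_univ ?_
      exact (((cK.comp (continuous_subtype_val.comp continuous_snd)).inner continuous_fst).sub
        (cF.comp continuous_fst)).add (ch.comp continuous_snd)
    convert h3 using 3 with w
    ext r
    simp
  have h1' : ContinuousOn (fun θ => sSup ((fun w => saddle M Φ ξ h θ w) '' Y)) X :=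
    continuousOn_iff_continuous_domRestrict.2 h1
  exact (h1'.comp continuousOn_fst fun z hz => hz.1).sub (h2.comp_continuousOn continuousOn_snd)

theorem continuousOn_objective (hG : IsUnit (gram Φ ξ).det) (H : Admissible X Y h) :
    ContinuousOn (fun z : Vec d × Vec d => 1 / 2 * mspbe M Φ ξ z.1 + h z.1) (X ×ˢ Y) := by
  have cK := continuous_K M Φ (ξ := ξ)
  have hm : Continuous (mspbe M Φ ξ) := by
    rw [funext fun θ => mspbe_eq M Φ hG θ]
    fun_prop
  exact (Continuous.continuousOn (by fun_prop)).add
    (H.continuousOn.comp continuousOn_fst fun z hz => hz.1)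

/-- If the dual maximizers are feasible, the duality gap bounds the primal suboptimality. -/
theorem objective_sub_le_dualityGap (hξ : IsPosDistribution ξ) (hG : IsUnit (gram Φ ξ).det)
    (H : Admissible X Y h)
    (hdual : ∀ θ ∈ X, Matrix.toEuclideanCLM (𝕜 := ℝ) (gram Φ ξ)⁻¹ (K M Φ ξ θ) ∈ Y)
    {z : Vec d × Vec d} (hz : z.1 ∈ X) {θ : Vec d} (hθ : θ ∈ X) :
    1 / 2 * mspbe M Φ ξ z.1 + h z.1 - (1 / 2 * mspbe M Φ ξ θ + h θ)
      ≤ dualityGap M Φ ξ h X Y z := by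
  have cK := continuous_K M Φ (ξ := ξ)
  have cF := continuous_Fstar Φ (ξ := ξ)
  have b1 : BddAbove ((fun w => saddle M Φ ξ h z.1 w) '' Y) := by
    refine (H.compactY.image ?_).bddAbove
    unfold saddle
    fun_prop
  have b2 : BddBelow ((fun θ => saddle M Φ ξ h θ z.2) '' X) := by
    refine (H.compactX.image_of_continuousOn ?_).bddBelow
    unfold saddle
    exact (Continuous.continuousOn (by fun_prop)).add H.continuousOn
  have h1 := le_csSup b1 ⟨_, hdual _ hz, rfl⟩
  have h2 := csInf_le b2 ⟨θ, hθ, rfl⟩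
  have h3 := saddle_le_half_mspbe M Φ hξ hG h θ z.2
  simp only at h1 h2
  rw [← half_mspbe_eq_saddle M Φ hG] at h1
  rw [dualityGap]
  linarith

end Gap

/-! ### The expected gap and the choice of stepsize -/

section Rate

variable {S : Type*} [Fintype S] [DecidableEq S] [MeasurableSpace S] [MeasurableSingletonClass S]
  {d : ℕ} {X Y : Set (Vec d)} {h : Vec d → ℝ} {M : MRP S} {Φ : Matrix S (Fin d) ℝ} {ξ : S → ℝ}
  {ν : Measure (S × ℝ × S)} [IsProbabilityMeasure ν] {a : ℝ}
  {Ω : Type*} {mΩ : MeasurableSpace Ω} {μ : Measure Ω} [IsProbabilityMeasure μ]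
  {x : ℕ → Ω → S × ℝ × S} {z₀ : Vec d × Vec d} {Q : S × ℝ × S → ℝ}

/-- The expected duality gap of GTD2-MP with a small constant stepsize `a`. -/
theorem integral_dualityGap_average_le (hξ : IsPosDistribution ξ) (hν : IsSampleLaw M ξ ν)
    (H : Admissible X Y h) (ha : 0 < a) (haL : a * (lipF Φ ξ + lipK M Φ ξ) ≤ 1 / 2)
    (hx : ∀ t, Measurable (x t)) (hind : iIndepFun x μ) (hlaw : ∀ t, μ.map (x t) = ν)
    (hz₀ : WithLp.toLp 2 z₀ ∈ feasible X Y) {D : ℝ} (hD0 : 0 ≤ D)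
    (hD : ∀ u ∈ feasible X Y, ∀ z ∈ feasible X Y, ‖u - z‖ ≤ D) (hQi : Integrable Q ν)
    (hQ : ∀ y, ∀ z ∈ feasible X Y, ‖noise M Φ ξ y z‖ ^ 2 ≤ Q y ∧ ∀ z' ∈ feasible X Y,
      ‖noise M Φ ξ y z - noise M Φ ξ y z'‖ ^ 2 ≤ Q y * ‖z - z'‖ ^ 2) {N : ℕ} (hN : 1 ≤ N) :
    ∫ ω, dualityGap M Φ ξ h X Y
        (average X Y h M.γ Φ (fun _ => a) (fun _ => a) (fun t => x t ω) z₀ N) ∂μ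
      ≤ (a * N)⁻¹ * (1 / 2 * D ^ 2 + a ^ 2 * ((6 + 2 * D ^ 2) * (N * ∫ y, Q y ∂ν))
        + a * (D * Real.sqrt (N * ∫ y, Q y ∂ν))) := by
  have hQ1 : ∀ y, ∀ z ∈ feasible X Y, ‖noise M Φ ξ y z‖ ^ 2 ≤ Q y := fun y z hz => (hQ y z hz).1
  have hgap : Integrable (fun ω => dualityGap M Φ ξ h X Y
      (average X Y h M.γ Φ (fun _ => a) (fun _ => a) (fun t => x t ω) z₀ N)) μ :=
    integrable_comp_of_continuousOn (H.compactX.prod H.compactY)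
      (continuousOn_dualityGap M Φ ξ H) (measurable_average H ha.le M.γ hx N)
      (fun ω => H.average_mem _ z₀ hN)
  obtain ⟨hsum, hsum_le⟩ := integral_norm_sum_noise_sq_le hξ hν H ha.le hx hind hlaw hz₀ hQi hQ1 N
  set n : ℕ → Ω → Pair d := fun t ω =>
    noise M Φ ξ (x t ω) (path X Y h M.γ Φ a (fun t => x t ω) z₀ t) with hn
  set W : ℕ → Ω → Pair d := fun t ω =>
    WithLp.toLp 2 z₀ - path X Y h M.γ Φ a (fun t => x t ω) z₀ t with hW
  have hWm : ∀ t, Measurable[past x t] (W t) := fun t =>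
    Measurable.const_sub (measurable_past_path H ha.le M.γ t) (WithLp.toLp 2 z₀)
  have hW2 : ∀ t, MemLp (W t) 2 μ := fun t =>
    MemLp.of_bound (Measurable.le (past_le hx t) (hWm t)).aestronglyMeasurable D
      (Filter.Eventually.of_forall fun ω => hD _ hz₀ _ (H.path_mem _ hz₀ t))
  have hin : ∀ t, Integrable (fun ω => (inner ℝ (n t ω) (W t ω) : ℝ)) μ := fun t =>
    integrable_inner_of_memLp (memLp_noise_path H ha.le hx hlaw hz₀ hQi hQ1 t) (hW2 t)
  -- `W t` is bounded and determined by the past, so this part of the noise disappears in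
  -- expectation.
  have h0 : ∀ t, ∫ ω, (inner ℝ (n t ω) (W t ω) : ℝ) ∂μ = 0 := fun t =>
    integral_inner_noise_eq_zero hξ hν H ha.le hx hind hlaw t (hWm t) (hin t)
  have i1 : Integrable (fun ω => 1 / 2 * D ^ 2
      + a ^ 2 * ((6 + 2 * D ^ 2) * ∑ t ∈ Finset.range N, Q (x t ω))) μ :=
    (integrable_const _).add (((integrable_finsetSum _ fun t _ =>
      integrable_comp_sample hx hlaw hQi t).const_mul _).const_mul _)
  have i2 : Integrable (fun ω => a * ∑ t ∈ Finset.range N, (inner ℝ (n t ω) (W t ω) : ℝ)) μ :=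
    (integrable_finsetSum _ fun t _ => hin t).const_mul _
  have i3 : Integrable (fun ω => a * (D * ‖∑ t ∈ Finset.range N, n t ω‖)) μ :=
    ((hsum.integrable (by norm_num)).norm.const_mul _).const_mul _
  have i12 : Integrable (fun ω => 1 / 2 * D ^ 2
      + a ^ 2 * ((6 + 2 * D ^ 2) * ∑ t ∈ Finset.range N, Q (x t ω))
      + a * ∑ t ∈ Finset.range N, (inner ℝ (n t ω) (W t ω) : ℝ)) μ := i1.add i2
  have i123 : Integrable (fun ω => 1 / 2 * D ^ 2
      + a ^ 2 * ((6 + 2 * D ^ 2) * ∑ t ∈ Finset.range N, Q (x t ω))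
      + a * ∑ t ∈ Finset.range N, (inner ℝ (n t ω) (W t ω) : ℝ)
      + a * (D * ‖∑ t ∈ Finset.range N, n t ω‖)) μ := i12.add i3
  refine (integral_mono hgap (i123.const_mul _) fun ω =>
    dualityGap_average_le M Φ hξ H ha haL hD hQ (fun t => x t ω) hz₀ hN).trans ?_
  rw [integral_const_mul, integral_add i12 i3, integral_add i1 i2,
    integral_add (integrable_const _) (((integrable_finsetSum _ fun t _ =>
      integrable_comp_sample hx hlaw hQi t).const_mul _).const_mul _),
    integral_const_mul, integral_const_mul, integral_const_mul, integral_const_mul,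
    integral_const_mul, integral_const_mul,
    integral_finsetSum _ fun t _ => integrable_comp_sample hx hlaw hQi t,
    integral_finsetSum _ fun t _ => hin t]
  simp only [h0, integral_comp_sample hx hlaw hQi, Finset.sum_const, Finset.card_range,
    nsmul_eq_mul, integral_const, probReal_univ, one_smul, mul_zero, add_zero]
  have hs := (integral_norm_le_sqrt hsum).trans (Real.sqrt_le_sqrt hsum_le)
  gcongr

end Rate

/-- The arithmetic behind the choice of the stepsize. -/
theorem stepsize_rate {c Lc σ n a D κ q : ℝ} (hc : 0 < c) (hσ : 0 ≤ σ) (hn : 0 < n)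
    (hL : 0 ≤ Lc) (hpos : 0 < Lc + σ * Real.sqrt n) (ha : a = c / (Lc + σ * Real.sqrt n))
    (hD : 0 ≤ D) (hκ : 0 ≤ κ) (hq : q ≤ κ * σ ^ 2) :
    (a * n)⁻¹ * (1 / 2 * D ^ 2 + a ^ 2 * ((6 + 2 * D ^ 2) * (n * q))
        + a * (D * Real.sqrt (n * q)))
      ≤ (D ^ 2 / (2 * c) + (6 + 2 * D ^ 2) * κ * c + D * Real.sqrt κ + 1)
        * (Lc / n + σ / Real.sqrt n) := by
  have hr : 0 < Real.sqrt n := Real.sqrt_pos.2 hn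
  have hrr : n = Real.sqrt n ^ 2 := (Real.sq_sqrt hn.le).symm
  have ha0 : 0 < a := by rw [ha]; positivity
  set r := Real.sqrt n with hr_def
  -- By the choice of `a`, 1/(an) is exactly (Lc/n + σ/√n)/c. The other two terms are O(σ/√n), the
  -- quadratic one by aσ√n ≤ c.
  have e1 : (a * n)⁻¹ * (1 / 2 * D ^ 2) = D ^ 2 / (2 * c) * (Lc / n + σ / r) := by
    rw [ha, hrr]
    field_simp
  have e2 : (a * n)⁻¹ * (a ^ 2 * ((6 + 2 * D ^ 2) * (n * q))) ≤
      (6 + 2 * D ^ 2) * κ * c * (σ / r) := by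
    have h1 : (a * n)⁻¹ * (a ^ 2 * ((6 + 2 * D ^ 2) * (n * q))) = (6 + 2 * D ^ 2) * (a * q) := by
      field_simp
    have h2 : a * (σ * r) ≤ c := by
      rw [ha, div_mul_eq_mul_div, div_le_iff₀ hpos]
      exact mul_le_mul_of_nonneg_left (by linarith) hc.le
    have h3 : a * q ≤ κ * c * (σ / r) := by
      calc a * q ≤ a * (κ * σ ^ 2) := mul_le_mul_of_nonneg_left hq ha0.le
        _ = κ * (a * (σ * r)) * (σ / r) := by field_simp
        _ ≤ κ * c * (σ / r) := by gcongr
    rw [h1, mul_assoc (6 + 2 * D ^ 2), mul_assoc (6 + 2 * D ^ 2)]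
    exact mul_le_mul_of_nonneg_left h3 (by positivity)
  have e3 : (a * n)⁻¹ * (a * (D * Real.sqrt (n * q))) ≤ D * Real.sqrt κ * (σ / r) := by
    have h1 : Real.sqrt (n * q) ≤ r * (Real.sqrt κ * σ) := by
      rw [Real.sqrt_mul hn.le]
      refine mul_le_mul_of_nonneg_left ?_ hr.le
      refine (Real.sqrt_le_sqrt hq).trans ?_
      rw [Real.sqrt_mul hκ, Real.sqrt_sq hσ]
    calc (a * n)⁻¹ * (a * (D * Real.sqrt (n * q)))
        ≤ (a * n)⁻¹ * (a * (D * (r * (Real.sqrt κ * σ)))) := by gcongr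
      _ = D * Real.sqrt κ * (σ / r) := by
          rw [hrr]
          field_simp
  have p1 : 0 ≤ Lc / n := by positivity
  have p2 : 0 ≤ σ / r := by positivity
  have p3 : 0 ≤ (6 + 2 * D ^ 2) * κ * c := by positivity
  have p4 : 0 ≤ D * Real.sqrt κ := by positivity
  rw [mul_add, mul_add, e1]
  nlinarith [mul_nonneg p3 p1, mul_nonneg p4 p1]

/-- The feature covariance vanishes only in dimension zero. -/
theorem subsingleton_of_lipF_eq_zero {S : Type*} [Fintype S] [DecidableEq S] {d : ℕ}
    {Φ : Matrix S (Fin d) ℝ} {ξ : S → ℝ} (hG : IsUnit (gram Φ ξ).det) (h0 : lipF Φ ξ = 0) :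
    Subsingleton (Vec d) := by
  refine ⟨fun v w => ?_⟩
  have h1 : Matrix.toEuclideanCLM (𝕜 := ℝ) (gram Φ ξ) = 0 := norm_eq_zero.1 h0
  have h2 := gram_apply_inv Φ hG v
  have h3 := gram_apply_inv Φ hG w
  rw [h1] at h2 h3
  rw [← h2, ← h3]
  rfl

/-- Uniformly over all samples, the noise on the feasible set is controlled by a function of the
sample whose mean is of the order of the oracle variance. -/
theorem exists_noise_bound {d : ℕ} {X Y : Set (Vec d)}
    (hZ : Bornology.IsBounded (feasible X Y)) (hne : (feasible X Y).Nonempty) :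
    ∃ κ : ℝ, 0 ≤ κ ∧
      ∀ (S : Type u) [Fintype S] [DecidableEq S] [MeasurableSpace S] [MeasurableSingletonClass S]
        (M : MRP S) (ξ : S → ℝ) (Φ : Matrix S (Fin d) ℝ)
        (ν : Measure (S × ℝ × S)) [IsProbabilityMeasure ν] (_ : IsSampleLaw M ξ ν)
        (σF σKθ σKy : ℝ) (_ : 0 ≤ σKy) (_ : OracleVarianceBound M Φ ξ ν X Y σF σKθ σKy),
        ∃ Q : S × ℝ × S → ℝ, Integrable Q ν ∧
          (∀ y, ∀ z ∈ feasible X Y, ‖noise M Φ ξ y z‖ ^ 2 ≤ Q y ∧ ∀ z' ∈ feasible X Y,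
            ‖noise M Φ ξ y z - noise M Φ ξ y z'‖ ^ 2 ≤ Q y * ‖z - z'‖ ^ 2) ∧
          ∫ y, Q y ∂ν ≤ κ * (Real.sqrt (σF ^ 2 + σKθ ^ 2) + σKy) ^ 2 := by
  obtain ⟨s, B, hs, hB, htest⟩ := exists_test_points hZ hne
  -- The test points lie in the feasible set, where the variance bounds hold; each contributes at
  -- most 2σ².
  refine ⟨B * (s.card * 2), by positivity, ?_⟩
  intro S _ _ _ _ M ξ Φ ν _ hν σF σKθ σKy hσ hvar
  have hi : ∀ p, Integrable (fun y => ‖noise M Φ ξ y p‖ ^ 2) ν := fun p =>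
    (memLp_two_iff_integrable_sq_norm (memLp_noise Φ hν p).1).1 (memLp_noise Φ hν p)
  refine ⟨fun y => B * ∑ p ∈ s, ‖noise M Φ ξ y p‖ ^ 2,
    (integrable_finsetSum _ fun p _ => hi p).const_mul _, fun y => htest (noise M Φ ξ y), ?_⟩
  rw [integral_const_mul, integral_finsetSum _ fun p _ => hi p, mul_assoc, mul_assoc]
  refine mul_le_mul_of_nonneg_left ?_ hB
  rw [← nsmul_eq_mul]
  exact Finset.sum_le_card_nsmul _ _ _ fun p hp =>
    integral_norm_noise_sq_le Φ hν hσ hvar (hs hp)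

end GTD2

/-! ### The main theorem -/

theorem proposition2 {d : ℕ} (X Y : Set (GTD2.Vec d))
    (hXc : IsCompact X) (hXconv : Convex ℝ X) (hXne : X.Nonempty)
    (hYc : IsCompact Y) (hYconv : Convex ℝ Y) (hYne : Y.Nonempty)
    (c : ℝ) (hc : 0 < c) (hc' : c ≤ 1 / 2) :
    ∃ C : ℝ, 0 < C ∧
      ∀ (S : Type u) [Fintype S] [DecidableEq S] [MeasurableSpace S] [MeasurableSingletonClass S]
        (M : GTD2.MRP S) (ξ : S → ℝ) (_ : GTD2.IsPosDistribution ξ)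
        (Φ : Matrix S (Fin d) ℝ) (_ : IsUnit (GTD2.gram Φ ξ).det)
        (h : GTD2.Vec d → ℝ) (_ : ConvexOn ℝ X h) (_ : ContinuousOn h X)
        (ν : Measure (S × ℝ × S)) [IsProbabilityMeasure ν] (_ : GTD2.IsSampleLaw M ξ ν)
        (σF σKθ σKy : ℝ) (_ : 0 ≤ σF) (_ : 0 ≤ σKθ) (_ : 0 ≤ σKy)
        (_ : GTD2.OracleVarianceBound M Φ ξ ν X Y σF σKθ σKy)
        (Ω : Type v) [MeasurableSpace Ω] (μ : Measure Ω) [IsProbabilityMeasure μ]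
        (x : ℕ → Ω → S × ℝ × S) (_ : ∀ t, Measurable (x t)) (_ : iIndepFun x μ)
        (_ : ∀ t, μ.map (x t) = ν)
        (z₀ : GTD2.Vec d × GTD2.Vec d) (_ : z₀.1 ∈ X) (_ : z₀.2 ∈ Y)
        (N : ℕ) (_ : 1 ≤ N),
        let L : ℝ := GTD2.lipF Φ ξ + GTD2.lipK M Φ ξ
        let σ : ℝ := Real.sqrt (σF ^ 2 + σKθ ^ 2) + σKy
        let α : ℕ → ℝ := fun _ => c / (L + σ * Real.sqrt N)
        let zbar : Ω → GTD2.Vec d × GTD2.Vec d := fun ω =>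
          GTD2.average X Y h M.γ Φ α α (fun t => x t ω) z₀ N
        (Integrable (fun ω => GTD2.dualityGap M Φ ξ h X Y (zbar ω)) μ ∧
          ∫ ω, GTD2.dualityGap M Φ ξ h X Y (zbar ω) ∂μ ≤ C * (L / N + σ / Real.sqrt N)) ∧
        ((∀ θ ∈ X, Matrix.toEuclideanCLM (𝕜 := ℝ) (GTD2.gram Φ ξ)⁻¹ (GTD2.K M Φ ξ θ) ∈ Y) →
          Integrable (fun ω => 1 / 2 * GTD2.mspbe M Φ ξ (zbar ω).1 + h (zbar ω).1) μ ∧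
          ∀ θ ∈ X, ∫ ω, (1 / 2 * GTD2.mspbe M Φ ξ (zbar ω).1 + h (zbar ω).1) ∂μ
            - (1 / 2 * GTD2.mspbe M Φ ξ θ + h θ) ≤ C * (L / N + σ / Real.sqrt N)) := by
  have hbdd : Bornology.IsBounded (GTD2.feasible X Y) :=
    (GTD2.Admissible.isCompact_feasible (h := fun _ => 0) ⟨hXc, hXne, hYc, hYconv, hYne,
      convexOn_const 0 hXconv, continuousOn_const⟩).isBounded
  have hne : (GTD2.feasible X Y).Nonempty :=
    ⟨WithLp.toLp 2 (hXne.some, hYne.some), hXne.some_mem, hYne.some_mem⟩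
  obtain ⟨κ, hκ, hnoise⟩ := GTD2.exists_noise_bound.{u} hbdd hne
  obtain ⟨R, hR⟩ := hbdd.exists_norm_le
  have hR0 : 0 ≤ R := (norm_nonneg _).trans (hR _ hne.some_mem)
  have hD : ∀ u ∈ GTD2.feasible X Y, ∀ z ∈ GTD2.feasible X Y, ‖u - z‖ ≤ 2 * R :=
    fun u hu z hz => by linarith [norm_sub_le u z, hR u hu, hR z hz]
  -- The constant of `stepsize_rate` with D = 2R. `R` and `κ` were fixed from X and Y before any
  -- process was chosen; the summand 1 makes the constant positive.
  refine ⟨(2 * R) ^ 2 / (2 * c) + (6 + 2 * (2 * R) ^ 2) * κ * c + 2 * R * Real.sqrt κ + 1,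
    by positivity, ?_⟩
  intro S _ _ _ _ M ξ hξ Φ hG h hconv hcont ν _ hν σF σKθ σKy _ _ hσKy hvar Ω _ μ _ x hx hind
    hlaw z₀ hz1 hz2 N hN L σ α zbar
  have H : GTD2.Admissible X Y h := ⟨hXc, hXne, hYc, hYconv, hYne, hconv, hcont⟩
  have hL : 0 ≤ L := add_nonneg (norm_nonneg _) (norm_nonneg _)
  have hσ : 0 ≤ σ := add_nonneg (Real.sqrt_nonneg _) hσKy
  have hN0 : (0 : ℝ) < N := by exact_mod_cast hN
  have hden : 0 ≤ L + σ * Real.sqrt N := by positivity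
  have ha : 0 ≤ c / (L + σ * Real.sqrt N) := by positivity
  have hmeas : Measurable zbar := GTD2.measurable_average H ha M.γ hx N
  have hmem : ∀ ω, zbar ω ∈ X ×ˢ Y := fun ω => H.average_mem _ z₀ hN
  have hgap : Integrable (fun ω => GTD2.dualityGap M Φ ξ h X Y (zbar ω)) μ :=
    GTD2.integrable_comp_of_continuousOn (hXc.prod hYc) (GTD2.continuousOn_dualityGap M Φ ξ H)
      hmeas hmem
  have hrate : ∫ ω, GTD2.dualityGap M Φ ξ h X Y (zbar ω) ∂μ
      ≤ ((2 * R) ^ 2 / (2 * c) + (6 + 2 * (2 * R) ^ 2) * κ * c + 2 * R * Real.sqrt κ + 1)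
        * (L / N + σ / Real.sqrt N) := by
    rcases hden.eq_or_lt with h0 | hpos
    · -- the stepsize is degenerate only in dimension zero
      have hF0 : GTD2.lipF Φ ξ = 0 := by
        have h1 : 0 ≤ σ * Real.sqrt N := by positivity
        have h2 : 0 ≤ GTD2.lipF Φ ξ := norm_nonneg _
        have h3 : 0 ≤ GTD2.lipK M Φ ξ := norm_nonneg _
        linarith
      have := GTD2.subsingleton_of_lipF_eq_zero hG hF0
      have hle : ∀ ω, GTD2.dualityGap M Φ ξ h X Y (zbar ω) ≤ 0 := fun ω =>
        GTD2.dualityGap_le M Φ hXne hYne fun w _ θ _ => by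
          rw [Subsingleton.elim θ (zbar ω).1, Subsingleton.elim w (zbar ω).2, sub_self]
      exact (integral_nonpos hle).trans (by positivity)
    · obtain ⟨Q, hQi, hQ, hQle⟩ := hnoise S M ξ Φ ν hν σF σKθ σKy hσKy hvar
      have ha' : 0 < c / (L + σ * Real.sqrt N) := by positivity
      -- This is where c ≤ 1/2 is needed.
      have haL : c / (L + σ * Real.sqrt N) * L ≤ 1 / 2 := by
        rw [div_mul_eq_mul_div, div_le_iff₀ hpos]
        nlinarith [mul_nonneg hσ (Real.sqrt_nonneg N)]
      exact (GTD2.integral_dualityGap_average_le hξ hν H ha' haL hx hind hlaw ⟨hz1, hz2⟩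
        (by positivity) hD hQi hQ hN).trans
        (GTD2.stepsize_rate hc hσ hN0 hL hpos rfl (by positivity) hκ hQle)
  refine ⟨⟨hgap, hrate⟩, fun hdual => ?_⟩
  have hobj : Integrable (fun ω => 1 / 2 * GTD2.mspbe M Φ ξ (zbar ω).1 + h (zbar ω).1) μ :=
    GTD2.integrable_comp_of_continuousOn (hXc.prod hYc) (GTD2.continuousOn_objective M Φ ξ hG H)
      hmeas hmem
  refine ⟨hobj, fun θ hθ => le_trans ?_ hrate⟩
  rw [sub_le_iff_le_add]
  calc ∫ ω, (1 / 2 * GTD2.mspbe M Φ ξ (zbar ω).1 + h (zbar ω).1) ∂μ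
      ≤ ∫ ω, (GTD2.dualityGap M Φ ξ h X Y (zbar ω)
          + (1 / 2 * GTD2.mspbe M Φ ξ θ + h θ)) ∂μ :=
        integral_mono hobj (hgap.add (integrable_const _)) fun ω => sub_le_iff_le_add.1
          (GTD2.objective_sub_le_dualityGap M Φ ξ hξ hG H hdual (hmem ω).1 hθ)
    _ = _ := by
        rw [integral_add hgap (integrable_const _), integral_const, probReal_univ, one_smul]
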